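/- Let $d\ge 1$ and let $\Omega\subset\mathbb R^d$ be a bounded open set with boundary $\partial\Omega=\overline\Omega\setminus\Omega$. Let $H^1(\Omega)$ be the Sobolev space of all real $u\in L^2(\Omega)$ with weak gradient $\nabla u\in L^2(\Omega)^d$, with its usual inner product $\int_\Omega (uv+\nabla u\cdot\nabla v)\,dx$, and write $\partial_\theta u=\theta\cdot\nabla u$ for $\theta$ in the unit sphere $\mathbb S^{d-1}$. For $\theta\in\mathbb S^{d-1}$ and $x\in\Omega$ let $\delta_\theta(x)=\sup\{s\ge 0: x+t\theta\in\Omega \text{ for all } t\in[0,s[\}$ and $\Phi_\theta(x)=x+\delta_\theta(x)\theta\in\partial\Omega$. Put $\partial_\theta\Omega=\Phi_\theta(\Omega)$, and for $z=\Phi_\theta(x)\in\partial_\theta\Omega$ put $\Phi_{-\theta}(z)=\Phi_{-\theta}(x)$, the other end of the chord of $\Omega$ parallel to $\theta$ that ends at $z$, and $\ell_{-\theta}(z)=|\Phi_{-\theta}(z)-z|$. Let $\mu_\theta$ be the finite Borel measure on $\partial\Omega$ given by $\mu_\theta(A)=\lambda^d(\{x\in\Omega:\Phi_\theta(x)\in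 A\})$; it is carried by $\partial_\theta\Omega$. Let $H_\theta=\theta^\perp$, let $\mathcal P_\theta$ be the orthogonal projection onto $H_\theta$, and for $y\in H_\theta$ let $\omega_\theta(y)=\{s\in\mathbb R: s\theta+y\in\Omega\}$. A function $g:\partial\Omega\to\mathbb R$ is a directional trace of $u\in H^1(\Omega)$ in the direction $\theta$ if there are a representative of $u$ and a set $A\subset\mathcal P_\theta(\Omega)$ such that $\mathcal P_\theta(\Omega)\setminus A$ is $\lambda^{d-1}$-negligible and, for every $y\in A$, the function $s\mapsto u(s\theta+y)$ belongs to $H^1(\omega_\theta(y))$ and, for every connected component $]\alpha,\beta[$ of $\omega_\theta(y)$, its representative that is continuous on $]\alpha,\beta]$ takes the value $g(\beta\theta+y)$ at $\beta$. Write $\gamma_\theta u$ for the set of all directional traces of $u$ in the direction $\theta$ (they are all equal $\mu_\theta$-a.e.). Let $\mathcal L^2(\partial\Omega,(\mu_\theta)_\theta)$ be the set of all $f:\partial\Omega\to\mathbb R$ that for every $\theta\in\mathbb S^{d-1}$ are $\mu_\theta$-a.e. equal to an element of $\mathcal L^2(\partial\Omega,\mu_\theta)$, with $\sup_{\theta}\int_{\partial\Omega}|f|^2\,d\mu_\theta<\infty$.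 Let $L^2(\partial\Omega,(\mu_\theta)_\theta)$ be the quotient by the relation "equal $\mu_\theta$-a.e. for every $\theta$", with the norm $\|f\|=\sup_\theta\big(\int_{\partial\Omega}|f|^2\,d\mu_\theta\big)^{1/2}$. Let $H^1_{\rm tr}(\Omega)$ be the set of all $u\in H^1(\Omega)$ for which there is $g\in L^2(\partial\Omega,(\mu_\theta)_\theta)$ with $g=\gamma_\theta u$ $\mu_\theta$-a.e. for every $\theta\in\mathbb S^{d-1}$, and then put ${\rm tr}(u)=g$. Then $H^1_{\rm tr}(\Omega)$ is a closed linear subspace of $H^1(\Omega)$, hence a Hilbert space. The operator ${\rm tr}:H^1_{\rm tr}(\Omega)\to L^2(\partial\Omega,(\mu_\theta)_{\theta\in\mathbb S^{d-1}})$ is well defined, linear and continuous. Moreover, for all $u,v\in H^1_{\rm tr}(\Omega)$ and all $\theta\in\mathbb S^{d-1}$, the integrand on the right-hand side below is $\mu_\theta$-integrable and $$\int_\Omega\big(u\,\partial_\theta v+v\,\partial_\theta u\big)\,dx=\int_{\partial\Omega}\frac{{\rm tr}(u)(z)\,{\rm tr}(v)(z)-{\rm tr}(u)(\Phi_{-\theta}(z))\,{\rm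 tr}(v)(\Phi_{-\theta}(z))}{\ell_{-\theta}(z)}\,d\mu_\theta(z).$$ -/

import Mathlib

open MeasureTheory Set Filter Topology
open scoped ENNReal ContDiff

noncomputable section

namespace OmniTrace

/-! ### Weak directional derivatives -/

/-- `φ ∈ C_c^∞(Ω)`. -/
def IsTestFunction {F : Type*} [NormedAddCommGroup F] [InnerProductSpace ℝ F]
    (Ω : Set F) (φ : F → ℝ) : Prop :=
  ContDiff ℝ ∞ φ ∧ HasCompactSupport φ ∧ tsupport φ ⊆ Ω

/-- `w` is a derivative of `u` along the vector `θ` in the weak sense on `Ω`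
(to be used for `u, w ∈ L²(Ω)`). -/
def HasWeakDirDeriv {F : Type*} [NormedAddCommGroup F] [InnerProductSpace ℝ F] [MeasureSpace F]
    (Ω : Set F) (u w : F → ℝ) (θ : F) : Prop :=
  ∀ φ : F → ℝ, IsTestFunction Ω φ →
    ∫ x in Ω, u x * fderiv ℝ φ x θ = - ∫ x in Ω, w x * φ x

section WeakDeriv

variable {F : Type*} [NormedAddCommGroup F] [InnerProductSpace ℝ F] [MeasureSpace F]
  [BorelSpace F] [IsFiniteMeasureOnCompacts (volume : Measure F)]

theorem IsTestFunction.memLp {Ω : Set F} {φ : F → ℝ} (hφ : IsTestFunction Ω φ) :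
    MemLp φ 2 (volume.restrict Ω) :=
  (hφ.1.continuous.memLp_of_hasCompactSupport hφ.2.1).restrict Ω

theorem IsTestFunction.memLp_fderiv {Ω : Set F} {φ : F → ℝ} (hφ : IsTestFunction Ω φ) (θ : F) :
    MemLp (fun x => fderiv ℝ φ x θ) 2 (volume.restrict Ω) := by
  have hc : Continuous (fun x => fderiv ℝ φ x θ) :=
    (hφ.1.continuous_fderiv (by simp)).clm_apply continuous_const
  have hs : HasCompactSupport (fun x => fderiv ℝ φ x θ) := hφ.2.1.fderiv_apply ℝ θ
  exact (hc.memLp_of_hasCompactSupport hs).restrict Ω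

theorem HasWeakDirDeriv.lincomb {Ω : Set F} {u₁ w₁ u₂ w₂ u w : F → ℝ} {θ : F} {a b : ℝ}
    (h₁ : HasWeakDirDeriv Ω u₁ w₁ θ) (h₂ : HasWeakDirDeriv Ω u₂ w₂ θ)
    (hu₁ : MemLp u₁ 2 (volume.restrict Ω)) (hw₁ : MemLp w₁ 2 (volume.restrict Ω))
    (hu₂ : MemLp u₂ 2 (volume.restrict Ω)) (hw₂ : MemLp w₂ 2 (volume.restrict Ω))
    (hu : u =ᵐ[volume.restrict Ω] fun x => a * u₁ x + b * u₂ x)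
    (hw : w =ᵐ[volume.restrict Ω] fun x => a * w₁ x + b * w₂ x) :
    HasWeakDirDeriv Ω u w θ := by
  intro φ hφ
  have e₁ : ∫ x in Ω, u x * fderiv ℝ φ x θ =
      ∫ x in Ω, (a * (u₁ x * fderiv ℝ φ x θ) + b * (u₂ x * fderiv ℝ φ x θ)) := by
    refine integral_congr_ae ?_
    filter_upwards [hu] with x hx
    rw [hx]; ring
  have e₂ : ∫ x in Ω, w x * φ x =
      ∫ x in Ω, (a * (w₁ x * φ x) + b * (w₂ x * φ x)) := by
    refine integral_congr_ae ?_
    filter_upwards [hw] with x hx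
    rw [hx]; ring
  rw [e₁, e₂, integral_add, integral_add, integral_const_mul, integral_const_mul,
    integral_const_mul, integral_const_mul, h₁ φ hφ, h₂ φ hφ]
  · ring
  · exact (hw₁.integrable_mul hφ.memLp).const_mul a
  · exact (hw₂.integrable_mul hφ.memLp).const_mul b
  · exact (hu₁.integrable_mul (hφ.memLp_fderiv θ)).const_mul a
  · exact (hu₂.integrable_mul (hφ.memLp_fderiv θ)).const_mul b

end WeakDeriv

/-- `f ∈ H¹(J)` for an open set `J` of the real line. -/
def MemH1Line (J : Set ℝ) (f : ℝ → ℝ) : Prop :=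
  MemLp f 2 (volume.restrict J) ∧
    ∃ w : ℝ → ℝ, MemLp w 2 (volume.restrict J) ∧ HasWeakDirDeriv J f w 1

/-! ### The space `H¹(Ω)` -/

/-- `ℝ^d` with its Euclidean norm. -/
abbrev Eu (d : ℕ) : Type := EuclideanSpace ℝ (Fin d)

/-- The unit sphere of `ℝ^d`. -/
abbrev Sph (d : ℕ) : Type := Metric.sphere (0 : Eu d) 1

/-- `L²(Ω) × L²(Ω)^d` with its Hilbert norm. -/
abbrev L2Pair {d : ℕ} (Ω : Set (Eu d)) : Type :=
  WithLp 2 (Lp ℝ 2 (volume.restrict Ω) × Lp (Eu d) 2 (volume.restrict Ω))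

/-- The Sobolev space `H¹(Ω)`, realised as the space of pairs `(u, ∇u)` with `u ∈ L²(Ω)` and
`∇u ∈ L²(Ω)^d` the weak gradient of `u` (which `u` determines): for every vector `θ`, `θ · ∇u` is
the weak derivative of `u` along `θ`. The induced inner product is
`∫_Ω (u v + ∇u · ∇v)`. -/
def H1 {d : ℕ} (Ω : Set (Eu d)) : Submodule ℝ (L2Pair Ω) where
  carrier := {p | ∀ θ : Eu d, HasWeakDirDeriv Ω p.fst (fun x => inner ℝ θ (p.snd x)) θ}
  zero_mem' := by
    intro θ φ hφ
    have h₁ : ((0 : L2Pair Ω).fst : Eu d → ℝ) =ᵐ[volume.restrict Ω] 0 := Lp.coeFn_zero _ _ _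
    have h₂ : ((0 : L2Pair Ω).snd : Eu d → Eu d) =ᵐ[volume.restrict Ω] 0 := Lp.coeFn_zero _ _ _
    rw [integral_eq_zero_of_ae, integral_eq_zero_of_ae, neg_zero]
    · filter_upwards [h₂] with x hx
      simp only [hx, Pi.zero_apply, inner_zero_right, zero_mul]
    · filter_upwards [h₁] with x hx
      simp only [hx, Pi.zero_apply, zero_mul]
  add_mem' := by
    intro p q hp hq θ
    have h₁ : ((p + q).fst : Eu d → ℝ) =ᵐ[volume.restrict Ω] p.fst + q.fst := Lp.coeFn_add _ _
    have h₂ : ((p + q).snd : Eu d → Eu d) =ᵐ[volume.restrict Ω] p.snd + q.snd := Lp.coeFn_add _ _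
    refine HasWeakDirDeriv.lincomb (a := 1) (b := 1) (hp θ) (hq θ) (Lp.memLp _)
      ((Lp.memLp p.snd).const_inner θ) (Lp.memLp _) ((Lp.memLp q.snd).const_inner θ) ?_ ?_
    · filter_upwards [h₁] with x hx
      simp only [hx, Pi.add_apply, one_mul]
    · filter_upwards [h₂] with x hx
      simp only [hx, Pi.add_apply, inner_add_right, one_mul]
  smul_mem' := by
    intro c p hp θ
    have h₁ : ((c • p).fst : Eu d → ℝ) =ᵐ[volume.restrict Ω] c • ⇑p.fst := Lp.coeFn_smul _ _
    have h₂ : ((c • p).snd : Eu d → Eu d) =ᵐ[volume.restrict Ω] c • ⇑p.snd := Lp.coeFn_smul _ _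
    refine HasWeakDirDeriv.lincomb (a := c) (b := 0) (hp θ) (hp θ) (Lp.memLp _)
      ((Lp.memLp p.snd).const_inner θ) (Lp.memLp _) ((Lp.memLp p.snd).const_inner θ) ?_ ?_
    · filter_upwards [h₁] with x hx
      simp only [hx, Pi.smul_apply, smul_eq_mul, zero_mul, add_zero]
    · filter_upwards [h₂] with x hx
      simp only [hx, Pi.smul_apply, inner_smul_right, zero_mul, add_zero]

/-- The underlying element of `L²(Ω)`, as a function. -/
def H1val {d : ℕ} {Ω : Set (Eu d)} (u : H1 Ω) : Eu d → ℝ := (u : L2Pair Ω).fst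

/-- The weak directional derivative `∂_θ u = θ · ∇u`. -/
def H1dirDeriv {d : ℕ} {Ω : Set (Eu d)} (u : H1 Ω) (θ : Eu d) : Eu d → ℝ :=
  fun x => inner ℝ θ ((u : L2Pair Ω).snd x)

/-! ### Geometry of chords and the directional measures -/

/-- `δ_θ(x) = sup {s ≥ 0 : x + tθ ∈ Ω for all t ∈ ]0,s[}`. For `x ∈ Ω` the value `t = 0` may be
added without change. For a boundary point `x` from which the chord in the direction `θ` runs
inside `Ω`, this is the length of that chord, i.e. the extension by continuity along the chord of
the length of the whole chord. -/
def chordDist {d : ℕ} (Ω : Set (Eu d)) (θ x : Eu d) : ℝ :=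
  sSup {s : ℝ | 0 ≤ s ∧ ∀ t ∈ Ioo 0 s, x + t • θ ∈ Ω}

/-- `Φ_θ(x) = x + δ_θ(x) θ`, the first boundary point met from `x` in the direction `θ`; defined
both for `x ∈ Ω` and, by continuous extension along the chord, for `x` in the part of the boundary
that `Ω` sees in the direction `-θ`. -/
def Phi {d : ℕ} (Ω : Set (Eu d)) (θ x : Eu d) : Eu d := x + chordDist Ω θ x • θ

/-- `ℓ_{-θ}(z) = |Φ_{-θ}(z) - z|`, the length of the chord parallel to `θ` that ends at `z`. -/
def chordLen {d : ℕ} (Ω : Set (Eu d)) (θ z : Eu d) : ℝ := ‖Phi Ω (-θ) z - z‖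

/-- The directional measure `μ_θ`, `μ_θ(A) = ∫_Ω χ_A(Φ_θ(x)) dx`, as a measure on `ℝ^d` carried by
`∂Ω`. Functions on `∂Ω` are accordingly represented by functions on `ℝ^d`, whose values off `∂Ω`
play no role up to `μ_θ`-a.e. equality. -/
def dirMeasure {d : ℕ} (Ω : Set (Eu d)) (θ : Eu d) : Measure (Eu d) :=
  Measure.map (Phi Ω θ) (volume.restrict Ω)

/-! ### Directional traces -/

/-- The hyperplane `H_θ = θ^⊥`. -/
abbrev Hyp {d : ℕ} (θ : Eu d) : Submodule ℝ (Eu d) := (Submodule.span ℝ {θ})ᗮ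

/-- The `(d-1)`-dimensional Lebesgue measure on `H_θ`. -/
def hypMeasure {d : ℕ} (θ : Eu d) : Measure (Hyp θ) :=
  (stdOrthonormalBasis ℝ (Hyp θ)).toBasis.addHaar

/-- `𝒫_θ(Ω)`, the orthogonal projection of `Ω` on `H_θ`. -/
def projSet {d : ℕ} (Ω : Set (Eu d)) (θ : Eu d) : Set (Hyp θ) :=
  (Hyp θ).orthogonalProjectionOnto '' Ω

/-- `ω_θ(y) = {s : sθ + y ∈ Ω}`. -/
def lineSection {d : ℕ} (Ω : Set (Eu d)) (θ y : Eu d) : Set ℝ := {s | s • θ + y ∈ Ω}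

/-- `]α,β[` is one of the bounded open intervals that are the components of the open set `J`. -/
def IsComponentInterval (J : Set ℝ) (α β : ℝ) : Prop :=
  α < β ∧ Ioo α β ⊆ J ∧ α ∉ J ∧ β ∉ J

/-- `g` is a directional trace of (the class of) `u` in the direction `θ`. As usual, an element of
`H¹` of an interval is identified with its continuous representative, here `f`. -/
def IsDirTrace {d : ℕ} (Ω : Set (Eu d)) (θ : Eu d) (u g : Eu d → ℝ) : Prop :=
  ∃ v : Eu d → ℝ, v =ᵐ[volume.restrict Ω] u ∧
    ∃ A ⊆ projSet Ω θ, hypMeasure θ (projSet Ω θ \ A) = 0 ∧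
      ∀ y ∈ A,
        MemH1Line (lineSection Ω θ y) (fun s => v (s • θ + y)) ∧
        ∀ α β : ℝ, IsComponentInterval (lineSection Ω θ y) α β →
          ∃ f : ℝ → ℝ, ContinuousOn f (Ioc α β) ∧
            f =ᵐ[volume.restrict (Ioo α β)] (fun s => v (s • θ + y)) ∧
            g (β • θ + y) = f β

/-! ### The space `L²` for a family of measures -/

section FamilyL2

variable {X ι : Type*} [MeasurableSpace X]

/-- `𝓛²(X, (m_i)_i)`: the functions that are, for every `i`, `m_i`-a.e. equal to an element of
`𝓛²(X, m_i)`, with a bound on the norms that does not depend on `i`. -/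
def calL2 (m : ι → Measure X) : Submodule ℝ (X → ℝ) where
  carrier := {f | ∃ M : ℝ, ∀ i, MemLp f 2 (m i) ∧ (eLpNorm f 2 (m i)).toReal ≤ M}
  zero_mem' := ⟨0, fun i => ⟨MemLp.zero, by simp⟩⟩
  add_mem' := by
    rintro f g ⟨M, hf⟩ ⟨N, hg⟩
    refine ⟨M + N, fun i => ⟨(hf i).1.add (hg i).1, ?_⟩⟩
    refine le_trans ?_ (add_le_add (hf i).2 (hg i).2)
    rw [← ENNReal.toReal_add (hf i).1.2.ne (hg i).1.2.ne]
    exact ENNReal.toReal_mono (ENNReal.add_ne_top.2 ⟨(hf i).1.2.ne, (hg i).1.2.ne⟩)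
      (eLpNorm_add_le (hf i).1.1 (hg i).1.1 (by norm_num))
  smul_mem' := by
    rintro c f ⟨M, hf⟩
    refine ⟨‖c‖ * M, fun i => ⟨(hf i).1.const_smul c, ?_⟩⟩
    rw [eLpNorm_const_smul, ENNReal.toReal_mul, toReal_enorm]
    exact mul_le_mul_of_nonneg_left (hf i).2 (norm_nonneg c)

/-- `𝓛²(X, (m_i)_i)` as a type of its own, to carry the seminorm below. -/
def CalL2 (m : ι → Measure X) : Type _ := ↥(calL2 m)

variable (m : ι → Measure X)

instance : AddCommGroup (CalL2 m) := inferInstanceAs (AddCommGroup ↥(calL2 m))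

instance : Module ℝ (CalL2 m) := inferInstanceAs (Module ℝ ↥(calL2 m))

variable {m}

/-- The underlying function. -/
def CalL2.toFun (f : CalL2 m) : X → ℝ := Subtype.val f

theorem CalL2.memLp (f : CalL2 m) (i : ι) : MemLp f.toFun 2 (m i) :=
  (Subtype.property f).choose_spec i |>.1

theorem CalL2.bddAbove (f : CalL2 m) :
    BddAbove (range fun i => (eLpNorm f.toFun 2 (m i)).toReal) := by
  obtain ⟨M, hM⟩ := Subtype.property f
  exact ⟨M, by rintro _ ⟨i, rfl⟩; exact (hM i).2⟩

variable (m) in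
/-- `‖f‖ = sup_i ‖f‖_{L²(m_i)}`. -/
instance : Norm (CalL2 m) := ⟨fun f => ⨆ i, (eLpNorm f.toFun 2 (m i)).toReal⟩

theorem CalL2.norm_def (f : CalL2 m) : ‖f‖ = ⨆ i, (eLpNorm f.toFun 2 (m i)).toReal := rfl

theorem CalL2.core : SeminormedSpace.Core ℝ (CalL2 m) where
  norm_nonneg f := Real.iSup_nonneg fun _ => ENNReal.toReal_nonneg
  norm_smul c f := by
    have h : ∀ i, (eLpNorm (c • f).toFun 2 (m i)).toReal =
        ‖c‖ * (eLpNorm f.toFun 2 (m i)).toReal := by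
      intro i
      have : (c • f).toFun = c • f.toFun := rfl
      rw [this, eLpNorm_const_smul, ENNReal.toReal_mul, toReal_enorm]
    rw [CalL2.norm_def, CalL2.norm_def, Real.mul_iSup_of_nonneg (norm_nonneg c)]
    exact iSup_congr h
  norm_triangle f g := by
    rw [CalL2.norm_def, CalL2.norm_def, CalL2.norm_def]
    refine Real.iSup_le (fun i => ?_) (add_nonneg
      (Real.iSup_nonneg fun _ => ENNReal.toReal_nonneg)
      (Real.iSup_nonneg fun _ => ENNReal.toReal_nonneg))
    refine le_trans ?_ (add_le_add (le_ciSup f.bddAbove i) (le_ciSup g.bddAbove i))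
    have : (f + g).toFun = f.toFun + g.toFun := rfl
    rw [this, ← ENNReal.toReal_add (f.memLp i).2.ne (g.memLp i).2.ne]
    exact ENNReal.toReal_mono (ENNReal.add_ne_top.2 ⟨(f.memLp i).2.ne, (g.memLp i).2.ne⟩)
      (eLpNorm_add_le (f.memLp i).1 (g.memLp i).1 (by norm_num))

variable (m) in
instance : SeminormedAddCommGroup (CalL2 m) := SeminormedAddCommGroup.ofCore CalL2.core

variable (m) in
instance : NormedSpace ℝ (CalL2 m) := ⟨fun c f => (CalL2.core.norm_smul c f).le⟩

variable (m) in
/-- `L²(X, (m_i)_i)`: the equivalence classes of `𝓛²(X, (m_i)_i)` for the relation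
"`m_i`-a.e. equal for every `i`" (see `L2Family.mk_eq_mk_iff`), normed by
`‖f‖ = sup_i ‖f‖_{L²(m_i)}`. -/
abbrev L2Family : Type _ := SeparationQuotient (CalL2 m)

/-- The class of a function. -/
def L2Family.mk (f : X → ℝ) (hf : f ∈ calL2 m) : L2Family m :=
  SeparationQuotient.mk (show CalL2 m from ⟨f, hf⟩)

theorem L2Family.mk_eq_mk_iff (f g : X → ℝ) (hf : f ∈ calL2 m) (hg : g ∈ calL2 m) :
    L2Family.mk f hf = L2Family.mk g hg ↔ ∀ i, f =ᵐ[m i] g := by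
  let f' : CalL2 m := ⟨f, hf⟩
  let g' : CalL2 m := ⟨g, hg⟩
  have hfg : ∀ i, MemLp (f - g) 2 (m i) := fun i => (f'.memLp i).sub (g'.memLp i)
  have key : L2Family.mk f hf = L2Family.mk g hg ↔ ‖f' - g'‖ = 0 := by
    rw [← dist_eq_norm, ← Metric.inseparable_iff]
    exact SeparationQuotient.mk_eq_mk
  rw [key]
  have hfun : (f' - g').toFun = f - g := rfl
  have hiff : ∀ i, (eLpNorm (f - g) 2 (m i)).toReal = 0 ↔ f =ᵐ[m i] g := by
    intro i
    rw [ENNReal.toReal_eq_zero_iff, or_iff_left (hfg i).2.ne,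
      eLpNorm_eq_zero_iff (hfg i).1 (by norm_num)]
    exact sub_ae_eq_zero f g
  constructor
  · intro h i
    rw [← hiff i]
    refine le_antisymm ?_ ENNReal.toReal_nonneg
    rw [← h, ← hfun]
    exact le_ciSup (f' - g').bddAbove i
  · intro h
    rw [CalL2.norm_def, hfun]
    simp only [(hiff _).2 (h _)]
    exact Real.iSup_const_zero

end FamilyL2

/-! ### The omnidirectional trace -/

/-- The family `(μ_θ)` indexed by the unit sphere. -/
def dirMeasures {d : ℕ} (Ω : Set (Eu d)) : Sph d → Measure (Eu d) := fun θ => dirMeasure Ω θ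

/-- `g` is (a representative of) an omnidirectional trace of `u`: it belongs to
`𝓛²(∂Ω, (μ_θ)_θ)` and, for every direction `θ`, it coincides `μ_θ`-a.e. with a directional trace
of `u` in the direction `θ`. -/
def IsOmniTrace {d : ℕ} (Ω : Set (Eu d)) (u : H1 Ω) (g : Eu d → ℝ) : Prop :=
  g ∈ calL2 (dirMeasures Ω) ∧
    ∀ θ : Sph d, ∃ h : Eu d → ℝ, IsDirTrace Ω θ (H1val u) h ∧ h =ᵐ[dirMeasure Ω θ] g

theorem MemH1Line.lincomb {J : Set ℝ} {f₁ f₂ : ℝ → ℝ} (a b : ℝ)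
    (h₁ : MemH1Line J f₁) (h₂ : MemH1Line J f₂) :
    MemH1Line J (fun s => a * f₁ s + b * f₂ s) := by
  obtain ⟨hf₁, w₁, hw₁, hd₁⟩ := h₁
  obtain ⟨hf₂, w₂, hw₂, hd₂⟩ := h₂
  exact ⟨(hf₁.const_mul a).add (hf₂.const_mul b), fun s => a * w₁ s + b * w₂ s,
    (hw₁.const_mul a).add (hw₂.const_mul b),
    hd₁.lincomb hd₂ hf₁ hw₁ hf₂ hw₂ (ae_eq_refl _) (ae_eq_refl _)⟩

theorem IsDirTrace.lincomb {d : ℕ} {Ω : Set (Eu d)} {θ : Eu d} {u₁ u₂ u g₁ g₂ : Eu d → ℝ}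
    {a b : ℝ} (h₁ : IsDirTrace Ω θ u₁ g₁) (h₂ : IsDirTrace Ω θ u₂ g₂)
    (hu : u =ᵐ[volume.restrict Ω] fun x => a * u₁ x + b * u₂ x) :
    IsDirTrace Ω θ u (fun z => a * g₁ z + b * g₂ z) := by
  obtain ⟨v₁, hv₁, A₁, hA₁, hn₁, ht₁⟩ := h₁
  obtain ⟨v₂, hv₂, A₂, hA₂, hn₂, ht₂⟩ := h₂
  refine ⟨fun x => a * v₁ x + b * v₂ x, ?_, A₁ ∩ A₂, fun y hy => hA₁ hy.1, ?_, ?_⟩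
  · filter_upwards [hv₁, hv₂, hu] with x h₁ h₂ h₃
    rw [h₁, h₂, h₃]
  · rw [sdiff_inter]
    exact measure_union_null hn₁ hn₂
  · rintro y ⟨hy₁, hy₂⟩
    refine ⟨(ht₁ y hy₁).1.lincomb a b (ht₂ y hy₂).1, fun α β hαβ => ?_⟩
    obtain ⟨f₁, hc₁, he₁, hg₁⟩ := (ht₁ y hy₁).2 α β hαβ
    obtain ⟨f₂, hc₂, he₂, hg₂⟩ := (ht₂ y hy₂).2 α β hαβ
    refine ⟨fun s => a * f₁ s + b * f₂ s,
      (continuousOn_const.mul hc₁).add (continuousOn_const.mul hc₂), ?_, ?_⟩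
    · filter_upwards [he₁, he₂] with s h₁ h₂
      rw [h₁, h₂]
    · simp only [hg₁, hg₂]

theorem IsOmniTrace.lincomb {d : ℕ} {Ω : Set (Eu d)} {u₁ u₂ u : H1 Ω} {g₁ g₂ : Eu d → ℝ}
    {a b : ℝ} (h₁ : IsOmniTrace Ω u₁ g₁) (h₂ : IsOmniTrace Ω u₂ g₂)
    (hu : H1val u =ᵐ[volume.restrict Ω] fun x => a * H1val u₁ x + b * H1val u₂ x) :
    IsOmniTrace Ω u (fun z => a * g₁ z + b * g₂ z) := by
  refine ⟨Submodule.add_mem _ (Submodule.smul_mem _ a h₁.1) (Submodule.smul_mem _ b h₂.1),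
    fun θ => ?_⟩
  obtain ⟨k₁, hk₁, he₁⟩ := h₁.2 θ
  obtain ⟨k₂, hk₂, he₂⟩ := h₂.2 θ
  refine ⟨_, hk₁.lincomb hk₂ hu, ?_⟩
  filter_upwards [he₁, he₂] with z h₁ h₂
  rw [h₁, h₂]

theorem isOmniTrace_zero {d : ℕ} (Ω : Set (Eu d)) : IsOmniTrace Ω 0 0 := by
  refine ⟨Submodule.zero_mem _, fun θ => ⟨0, ⟨0, (Lp.coeFn_zero _ _ _).symm, projSet Ω θ,
    Subset.rfl, by simp, fun y _ => ⟨⟨MemLp.zero', 0, MemLp.zero, ?_⟩, ?_⟩⟩, ae_eq_refl _⟩⟩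
  · intro φ _
    simp
  · intro α β _
    exact ⟨fun _ => 0, continuousOn_const, ae_eq_refl _, rfl⟩

/-- `H¹_tr(Ω)`: the elements of `H¹(Ω)` having an omnidirectional trace on `∂Ω`, with the norm
and inner product of `H¹(Ω)`. -/
def H1tr {d : ℕ} (Ω : Set (Eu d)) : Submodule ℝ (H1 Ω) where
  carrier := {u | ∃ g, IsOmniTrace Ω u g}
  zero_mem' := ⟨0, isOmniTrace_zero Ω⟩
  add_mem' := by
    rintro u v ⟨g, hg⟩ ⟨h, hh⟩
    refine ⟨_, hg.lincomb (a := 1) (b := 1) hh ?_⟩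
    filter_upwards [Lp.coeFn_add (u : L2Pair Ω).fst (v : L2Pair Ω).fst] with x hx
    rw [one_mul, one_mul]
    exact hx
  smul_mem' := by
    rintro c u ⟨g, hg⟩
    refine ⟨_, hg.lincomb (a := c) (b := 0) hg ?_⟩
    filter_upwards [Lp.coeFn_smul c (u : L2Pair Ω).fst] with x hx
    rw [zero_mul, add_zero]
    exact hx

/-- The space `L²(∂Ω, (μ_θ)_θ)`. -/
abbrev BoundaryL2 {d : ℕ} (Ω : Set (Eu d)) : Type := L2Family (dirMeasures Ω)

/-- The omnidirectional trace operator: the class of an omnidirectional trace of `u`. -/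
def tr {d : ℕ} (Ω : Set (Eu d)) (u : H1tr Ω) : BoundaryL2 Ω :=
  L2Family.mk u.2.choose u.2.choose_spec.1

end OmniTrace

end

open OmniTrace

noncomputable section

namespace OmniTrace

/-! ### Chords of an open set -/

section Chord

variable {F : Type*} [NormedAddCommGroup F] [NormedSpace ℝ F]

/-! Everything reduces to an identity on `Ω`. On almost every chord parallel to `θ`, an element `u`
of `H¹(Ω)` is a primitive of `∂_θ u`, hence has a limit at the exit point. Read off from a point `x`
of the chord, this limit is `endVal`, that is, `u x` plus the integral of `∂_θ u` from `x` to the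
exit point. Since `μ_θ` is the image of Lebesgue measure under `Φ_θ`, a function `g` of `𝓛²(∂Ω,
(μ_θ)_θ)` is an omnidirectional trace exactly when `g ∘ Φ_θ = endVal` a.e. on `Ω` for every `θ`
(`isOmniTrace_iff`).

Fubini along chords takes the form of `lintegral_chord` and `integral_chord`: replacing a function
by its average over the chord through each point does not change its integral over `Ω`. With
Cauchy–Schwarz on each chord this gives `‖endVal‖ ≤ ‖u‖ + 4r ‖∂_θ u‖` in `L²(Ω)` when `Ω` lies in
the ball of radius `r` about `0`. The bound does not depend on `θ`; it yields uniqueness and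
Lipschitz continuity of the trace.

For closedness, one function `G` must serve uncountably many directions. Along a sequence converging
at a geometric rate in `H¹(Ω)`, the traces converge pointwise `μ_θ`-a.e. for every `θ`, so their
pointwise limit, defined without reference to `θ`, is a trace of the limit
(`exists_isOmniTrace_of_geometric`).

The integral formula is the product rule on each chord, divided by the chord length and averaged;
the far end of the chord is handled by the trace in the direction `-θ`.

The chord lemmas are stated in a general space because they serve twice: for `Ω` itself and, with
direction `1`, for the sections `ω_θ(y)` of the line. `exitTime` has the same body as `chordDist`.
-/

/-- The parameters `t` for which the segment from `x` to `x + tθ` lies in `Ω`. -/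
def chord (Ω : Set F) (θ x : F) : Set ℝ := {t | ∀ τ ∈ uIcc 0 t, x + τ • θ ∈ Ω}

/-- The time at which the ray from `x` in the direction `θ` leaves `Ω`. -/
def exitTime (Ω : Set F) (θ x : F) : ℝ :=
  sSup {s : ℝ | 0 ≤ s ∧ ∀ t ∈ Ioo 0 s, x + t • θ ∈ Ω}

variable {Ω : Set F} {θ x : F} {t : ℝ}

theorem mem_of_mem_chord (h : t ∈ chord Ω θ x) : x ∈ Ω := by
  simpa using h 0 left_mem_uIcc

theorem add_smul_mem_of_mem_chord (h : t ∈ chord Ω θ x) : x + t • θ ∈ Ω :=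
  h t right_mem_uIcc

theorem zero_mem_chord (h : x ∈ Ω) : (0 : ℝ) ∈ chord Ω θ x := by
  intro τ hτ
  have : τ = 0 := by simpa using hτ
  simpa [this] using h

/-- Of the three segments joining three collinear points, each is covered by the other two. Moving
the base point along its chord therefore only translates the parameter set. -/
theorem chord_add_smul (ht : t ∈ chord Ω θ x) (s : ℝ) :
    s ∈ chord Ω θ (x + t • θ) ↔ t + s ∈ chord Ω θ x := by
  have key : ∀ τ : ℝ, x + t • θ + τ • θ = x + (t + τ) • θ := fun τ => by
    rw [add_smul, add_assoc]
  constructor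
  · intro h τ hτ
    by_cases h1 : τ ∈ uIcc 0 t
    · exact ht τ h1
    · have := h (τ - t) (by rw [mem_uIcc] at *; grind)
      rwa [key, add_sub_cancel] at this
  · intro h τ hτ
    rw [key]
    by_cases h1 : t + τ ∈ uIcc 0 t
    · exact ht _ h1
    · exact h _ (by rw [mem_uIcc] at *; grind)

theorem neg_mem_chord_add_smul (ht : t ∈ chord Ω θ x) : -t ∈ chord Ω θ (x + t • θ) := by
  rw [chord_add_smul ht]
  simpa using zero_mem_chord (mem_of_mem_chord ht)

theorem neg_mem_chord_add_smul_iff : -t ∈ chord Ω θ (x + t • θ) ↔ t ∈ chord Ω θ x := by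
  refine ⟨fun h => ?_, neg_mem_chord_add_smul⟩
  simpa [add_assoc] using neg_mem_chord_add_smul h

/-- Rescaling to a fixed compact parameter interval makes the tube lemma available for openness in
`(x, t)` jointly. -/
theorem mem_chord_iff_unitInterval :
    t ∈ chord Ω θ x ↔ ∀ σ ∈ Icc (0 : ℝ) 1, x + (σ * t) • θ ∈ Ω := by
  constructor
  · intro h σ hσ
    refine h _ ?_
    rcases le_total 0 t with ht | ht
    · rw [uIcc_of_le ht]
      exact ⟨mul_nonneg hσ.1 ht, by nlinarith [hσ.2]⟩
    · rw [uIcc_of_ge ht]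
      exact ⟨by nlinarith [hσ.2], mul_nonpos_of_nonneg_of_nonpos hσ.1 ht⟩
  · intro h τ hτ
    by_cases h0 : t = 0
    · subst h0
      have : τ = 0 := by simpa using hτ
      simpa [this] using h 0 (by simp)
    · have := h (τ / t) ?_
      · rwa [div_mul_cancel₀ _ h0] at this
      · rw [mem_uIcc] at hτ
        rcases hτ with ⟨h1, h2⟩ | ⟨h1, h2⟩
        · have ht : 0 < t := lt_of_le_of_ne (h1.trans h2) (Ne.symm h0)
          exact ⟨by positivity, (div_le_one ht).2 h2⟩
        · have ht : t < 0 := lt_of_le_of_ne (h1.trans h2) h0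
          exact ⟨div_nonneg_of_nonpos h2 ht.le, (div_le_one_of_neg ht).2 h1⟩

theorem isOpen_chord_prod (hΩ : IsOpen Ω) (θ : F) :
    IsOpen {p : F × ℝ | p.2 ∈ chord Ω θ p.1} := by
  rw [isOpen_iff_eventually]
  rintro ⟨x, t⟩ h
  simp only [mem_ofPred_eq, mem_chord_iff_unitInterval] at h ⊢
  refine isCompact_Icc.eventually_forall_of_forall_eventually fun σ hσ => ?_
  have hc : Continuous fun z : (F × ℝ) × ℝ => z.1.1 + (z.2 * z.1.2) • θ := by fun_prop
  exact hc.continuousAt.eventually_mem (hΩ.mem_nhds (h σ hσ))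

theorem isOpen_chord (hΩ : IsOpen Ω) (θ x : F) : IsOpen (chord Ω θ x) :=
  (isOpen_chord_prod hΩ θ).preimage (by fun_prop : Continuous fun t : ℝ => (x, t))

theorem isOpen_mem_chord (hΩ : IsOpen Ω) (θ : F) (t : ℝ) : IsOpen {x | t ∈ chord Ω θ x} :=
  (isOpen_chord_prod hΩ θ).preimage (by fun_prop : Continuous fun x : F => (x, t))

/-- The point `x` itself need not lie in `Ω`, since `t = 0` is excluded from the defining condition.
The lemma can thus be used from a boundary point looking back along a chord. -/
theorem exitTime_eq {b : ℝ} (hb : 0 < b) (h : ∀ t ∈ Ioo 0 b, x + t • θ ∈ Ω)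
    (hn : x + b • θ ∉ Ω) : exitTime Ω θ x = b := by
  have : {s : ℝ | 0 ≤ s ∧ ∀ t ∈ Ioo 0 s, x + t • θ ∈ Ω} = Icc 0 b := by
    ext s
    refine ⟨fun hs => ⟨hs.1, ?_⟩, fun hs => ⟨hs.1, fun t ht => h t ⟨ht.1, ht.2.trans_le hs.2⟩⟩⟩
    by_contra! hlt
    exact hn (hs.2 b ⟨hb, hlt⟩)
  rw [exitTime, this, csSup_Icc hb.le]

theorem exitTime_bound {r : ℝ} (hr : Ω ⊆ Metric.closedBall 0 r) (hθ : ‖θ‖ = 1) {s : ℝ}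
    (hx : x ∈ Ω) (h : ∀ t ∈ Ioo 0 s, x + t • θ ∈ Ω) : s ≤ 2 * r := by
  have h1 : ‖x‖ ≤ r := by simpa using hr hx
  refine le_of_forall_lt fun t ht => ?_
  by_contra! hcon
  have hr0 : 0 ≤ r := (norm_nonneg x).trans h1
  obtain ⟨t', h2, h3⟩ := exists_between ht
  have h4 : ‖x + t' • θ‖ ≤ r := by simpa using hr (h t' ⟨by linarith, h3⟩)
  have h5 : ‖t' • θ‖ ≤ ‖x + t' • θ‖ + ‖x‖ := by
    simpa using norm_sub_le (x + t' • θ) x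
  rw [norm_smul, hθ, mul_one, Real.norm_eq_abs] at h5
  have := le_abs_self t'
  linarith

theorem exitTime_spec (hΩ : IsOpen Ω) {r : ℝ} (hr : Ω ⊆ Metric.closedBall 0 r) (hθ : ‖θ‖ = 1)
    (hx : x ∈ Ω) : 0 < exitTime Ω θ x ∧ exitTime Ω θ x ≤ 2 * r ∧
      (∀ t ∈ Ico 0 (exitTime Ω θ x), x + t • θ ∈ Ω) ∧ x + exitTime Ω θ x • θ ∉ Ω := by
  set S := {s : ℝ | 0 ≤ s ∧ ∀ t ∈ Ioo 0 s, x + t • θ ∈ Ω} with hS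
  have hbdd : BddAbove S := ⟨2 * r, fun s hs => exitTime_bound hr hθ hx hs.2⟩
  have hne : S.Nonempty := ⟨0, le_rfl, by simp⟩
  have hcont : Continuous fun t : ℝ => x + t • θ := by fun_prop
  have hin : ∀ t ∈ Ico 0 (exitTime Ω θ x), x + t • θ ∈ Ω := by
    intro t ht
    rcases ht.1.eq_or_lt with h0 | h0
    · simpa [← h0] using hx
    · obtain ⟨s, hs, hts⟩ := exists_lt_of_lt_csSup hne ht.2
      exact hs.2 t ⟨h0, hts⟩
  -- An admissible segment with endpoint in `Ω` can be prolonged, `Ω` being open. With `b = 0` this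
  -- gives positivity; with `b` the exit time it shows that the exit point is outside `Ω`.
  have hge : ∀ b : ℝ, 0 ≤ b → (∀ t ∈ Ico 0 b, x + t • θ ∈ Ω) → x + b • θ ∈ Ω →
      b < exitTime Ω θ x := by
    intro b hb h1 h2
    obtain ⟨ε, hε, h3⟩ := Metric.isOpen_iff.1 (hΩ.preimage hcont) b h2
    have : b + ε ∈ S := by
      refine ⟨by linarith, fun t ht => ?_⟩
      rcases lt_or_ge t b with h4 | h4
      · exact h1 t ⟨ht.1.le, h4⟩
      · refine h3 ?_
        rw [Metric.mem_ball, Real.dist_eq, abs_of_nonneg (by linarith)]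
        linarith [ht.2]
    have := le_csSup hbdd this
    change b < sSup S
    linarith
  have hpos : 0 < exitTime Ω θ x := hge 0 le_rfl (by simp) (by simpa using hx)
  exact ⟨hpos, csSup_le hne fun s hs => exitTime_bound hr hθ hx hs.2, hin,
    fun h => lt_irrefl _ (hge _ hpos.le hin h)⟩

theorem chord_eq_Ioo (hΩ : IsOpen Ω) {r : ℝ} (hr : Ω ⊆ Metric.closedBall 0 r) (hθ : ‖θ‖ = 1)
    (hx : x ∈ Ω) : chord Ω θ x = Ioo (-exitTime Ω (-θ) x) (exitTime Ω θ x) := by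
  obtain ⟨h1, -, h2, h3⟩ := exitTime_spec hΩ hr hθ hx
  obtain ⟨k1, -, k2, k3⟩ := exitTime_spec hΩ hr (θ := -θ) (by simpa using hθ) hx
  have k2' : ∀ t ∈ Ioc (-exitTime Ω (-θ) x) 0, x + t • θ ∈ Ω := fun t ht => by
    have := k2 (-t) ⟨by linarith [ht.2], by linarith [ht.1]⟩
    rwa [smul_neg, neg_smul, neg_neg] at this
  ext t
  constructor
  · intro ht
    constructor
    · by_contra! hcon
      refine k3 ?_
      have := ht (-exitTime Ω (-θ) x) (by rw [mem_uIcc]; right; constructor <;> linarith)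
      rwa [smul_neg, ← neg_smul]
    · by_contra! hcon
      exact h3 (ht _ (by rw [mem_uIcc]; left; constructor <;> linarith))
  · intro ht τ hτ
    rw [mem_uIcc] at hτ
    rcases le_or_gt 0 τ with h0 | h0
    · refine h2 τ ⟨h0, ?_⟩
      rcases hτ with h | h
      · exact h.2.trans_lt ht.2
      · linarith [h.2]
    · refine k2' τ ⟨?_, h0.le⟩
      rcases hτ with h | h
      · linarith [h.1]
      · exact ht.1.trans_le h.1

theorem volume_chord (hΩ : IsOpen Ω) {r : ℝ} (hr : Ω ⊆ Metric.closedBall 0 r) (hθ : ‖θ‖ = 1)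
    (hx : x ∈ Ω) : volume (chord Ω θ x) =
      ENNReal.ofReal (exitTime Ω θ x + exitTime Ω (-θ) x) := by
  rw [chord_eq_Ioo hΩ hr hθ hx, Real.volume_Ioo, sub_neg_eq_add]

theorem volume_chord_ne_zero (hΩ : IsOpen Ω) {r : ℝ} (hr : Ω ⊆ Metric.closedBall 0 r)
    (hθ : ‖θ‖ = 1) (hx : x ∈ Ω) : volume (chord Ω θ x) ≠ 0 := by
  rw [volume_chord hΩ hr hθ hx]
  have := (exitTime_spec hΩ hr hθ hx).1
  have := (exitTime_spec hΩ hr (θ := -θ) (by simpa using hθ) hx).1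
  simp only [ne_eq, ENNReal.ofReal_eq_zero, not_le]
  linarith

theorem volume_chord_ne_top (hΩ : IsOpen Ω) {r : ℝ} (hr : Ω ⊆ Metric.closedBall 0 r)
    (hθ : ‖θ‖ = 1) (hx : x ∈ Ω) : volume (chord Ω θ x) ≠ ⊤ := by
  rw [volume_chord hΩ hr hθ hx]
  exact ENNReal.ofReal_ne_top

theorem volume_chord_add_smul (ht : t ∈ chord Ω θ x) :
    volume (chord Ω θ (x + t • θ)) = volume (chord Ω θ x) := by
  have : chord Ω θ (x + t • θ) = (fun s => t + s) ⁻¹' chord Ω θ x := by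
    ext s; exact chord_add_smul ht s
  rw [this, measure_preimage_add]

end Chord

/-! ### Averaging over chords preserves the integral -/

section ChordIntegral

theorem measurable_volume_chord {F : Type*} [NormedAddCommGroup F] [NormedSpace ℝ F]
    [SecondCountableTopology F] [MeasurableSpace F] [BorelSpace F] {Ω : Set F} (hΩ : IsOpen Ω)
    (θ : F) : Measurable fun x => volume (chord Ω θ x) :=
  measurable_measure_prodMk_left (ν := (volume : Measure ℝ)) (isOpen_chord_prod hΩ θ).measurableSet

variable {F : Type*} [NormedAddCommGroup F] [InnerProductSpace ℝ F] [FiniteDimensional ℝ F]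
  [MeasureSpace F] [BorelSpace F] [(volume : Measure F).IsAddHaarMeasure]

/-- The shear `(x, t) ↦ (x + tθ, -t)`, an involution. -/
def shear (θ : F) : F × ℝ ≃ᵐ F × ℝ where
  toFun p := (p.1 + p.2 • θ, -p.2)
  invFun p := (p.1 + p.2 • θ, -p.2)
  left_inv p := by simp [add_assoc]
  right_inv p := by simp [add_assoc]
  measurable_toFun := by
    change Measurable fun p : F × ℝ => (p.1 + p.2 • θ, -p.2)
    fun_prop
  measurable_invFun := by
    change Measurable fun p : F × ℝ => (p.1 + p.2 • θ, -p.2)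
    fun_prop

/-- For fixed `t` the map is a translation in `x`, fibred over the reflection `t ↦ -t`. -/
theorem measurePreserving_shear (θ : F) :
    MeasurePreserving (shear θ) ((volume : Measure F).prod (volume : Measure ℝ))
      ((volume : Measure F).prod (volume : Measure ℝ)) := by
  have h : MeasurePreserving (fun p : ℝ × F => (-p.1, p.2 + p.1 • θ))
      ((volume : Measure ℝ).prod (volume : Measure F))
      ((volume : Measure ℝ).prod (volume : Measure F)) := by
    refine (Measure.measurePreserving_neg (volume : Measure ℝ)).skew_product
      (g := fun t x => x + t • θ) (by fun_prop) ?_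
    exact Eventually.of_forall fun t => map_add_right_eq_self _ _
  exact (Measure.measurePreserving_swap.comp h).comp Measure.measurePreserving_swap

variable {Ω : Set F} {θ : F}

/-- The shear exchanges the two points `x` and `x + tθ` of a common chord: it preserves the set of
pairs `(x, t)` with `t` in the chord of `x`, and the chord length is the same at both points. Hence
`f (x + tθ)` may be replaced by `f x`, after which the `t`-integral cancels the normalisation. -/
theorem lintegral_chord (hΩ : IsOpen Ω) (hb : Bornology.IsBounded Ω) (hθ : ‖θ‖ = 1)
    {f : F → ℝ≥0∞} (hf : Measurable f) :
    ∫⁻ x in Ω, (volume (chord Ω θ x))⁻¹ * ∫⁻ t in chord Ω θ x, f (x + t • θ) =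
      ∫⁻ x in Ω, f x := by
  obtain ⟨r, hr⟩ := hb.subset_closedBall 0
  set S : Set (F × ℝ) := {p | p.2 ∈ chord Ω θ p.1}
  have hS : MeasurableSet S := (isOpen_chord_prod hΩ θ).measurableSet
  have hV := measurable_volume_chord hΩ θ
  have hmeas : Measurable (S.indicator fun p : F × ℝ => (volume (chord Ω θ p.1))⁻¹ *
      f (p.1 + p.2 • θ)) :=
    ((hV.comp measurable_fst).inv.mul (hf.comp (by fun_prop))).indicator hS
  have hmeas' : Measurable (S.indicator fun p : F × ℝ => (volume (chord Ω θ p.1))⁻¹ * f p.1) :=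
    ((hV.comp measurable_fst).inv.mul (hf.comp measurable_fst)).indicator hS
  have e₁ : ∫⁻ p, S.indicator (fun p : F × ℝ => (volume (chord Ω θ p.1))⁻¹ *
      f (p.1 + p.2 • θ)) p ∂((volume : Measure F).prod (volume : Measure ℝ)) =
      ∫⁻ x in Ω, (volume (chord Ω θ x))⁻¹ * ∫⁻ t in chord Ω θ x, f (x + t • θ) := by
    rw [lintegral_prod _ hmeas.aemeasurable, ← lintegral_indicator hΩ.measurableSet]
    refine lintegral_congr fun x => ?_
    have : ∀ t, S.indicator (fun p : F × ℝ => (volume (chord Ω θ p.1))⁻¹ *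
        f (p.1 + p.2 • θ)) (x, t) =
        (chord Ω θ x).indicator (fun t => (volume (chord Ω θ x))⁻¹ * f (x + t • θ)) t :=
      fun t => rfl
    simp_rw [this]
    rw [lintegral_indicator (isOpen_chord hΩ θ x).measurableSet,
      lintegral_const_mul _ (by fun_prop)]
    by_cases hx : x ∈ Ω
    · rw [indicator_of_mem hx]
    · rw [indicator_of_notMem hx]
      have : chord Ω θ x = ∅ := eq_empty_of_forall_notMem fun t ht => hx (mem_of_mem_chord ht)
      simp [this]
  have e₂ : ∫⁻ p, S.indicator (fun p : F × ℝ => (volume (chord Ω θ p.1))⁻¹ * f p.1) p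
      ∂((volume : Measure F).prod (volume : Measure ℝ)) = ∫⁻ x in Ω, f x := by
    rw [lintegral_prod _ hmeas'.aemeasurable, ← lintegral_indicator hΩ.measurableSet]
    refine lintegral_congr fun x => ?_
    have : ∀ t, S.indicator (fun p : F × ℝ => (volume (chord Ω θ p.1))⁻¹ * f p.1) (x, t) =
        (chord Ω θ x).indicator (fun _ => (volume (chord Ω θ x))⁻¹ * f x) t := fun t => rfl
    simp_rw [this]
    rw [lintegral_indicator (isOpen_chord hΩ θ x).measurableSet, setLIntegral_const]
    by_cases hx : x ∈ Ω
    · rw [indicator_of_mem hx, mul_right_comm, ENNReal.inv_mul_cancel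
        (volume_chord_ne_zero hΩ hr hθ hx) (volume_chord_ne_top hΩ hr hθ hx), one_mul]
    · rw [indicator_of_notMem hx]
      have : chord Ω θ x = ∅ := eq_empty_of_forall_notMem fun t ht => hx (mem_of_mem_chord ht)
      simp [this]
  rw [← e₁, ← e₂, ← (measurePreserving_shear θ).lintegral_comp hmeas]
  refine lintegral_congr fun p => ?_
  by_cases hp : p ∈ S
  · have hp' : shear θ p ∈ S := neg_mem_chord_add_smul hp
    rw [indicator_of_mem hp, indicator_of_mem hp']
    change (volume (chord Ω θ (p.1 + p.2 • θ)))⁻¹ * f (p.1 + p.2 • θ + (-p.2) • θ) = _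
    rw [volume_chord_add_smul hp]
    simp [add_assoc]
  · have hp' : shear θ p ∉ S := fun h => hp (neg_mem_chord_add_smul_iff.1 h)
    rw [indicator_of_notMem hp, indicator_of_notMem hp']

theorem integral_chord (hΩ : IsOpen Ω) (hb : Bornology.IsBounded Ω) (hθ : ‖θ‖ = 1)
    {f : F → ℝ} (hf : StronglyMeasurable f) (hi : IntegrableOn f Ω) :
    IntegrableOn (fun x => (volume (chord Ω θ x)).toReal⁻¹ * ∫ t in chord Ω θ x, f (x + t • θ)) Ω ∧
    ∫ x in Ω, (volume (chord Ω θ x)).toReal⁻¹ * ∫ t in chord Ω θ x, f (x + t • θ) =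
      ∫ x in Ω, f x := by
  obtain ⟨r, hr⟩ := hb.subset_closedBall 0
  set S : Set (F × ℝ) := {p | p.2 ∈ chord Ω θ p.1}
  have hS : MeasurableSet S := (isOpen_chord_prod hΩ θ).measurableSet
  have hV : StronglyMeasurable fun x => (volume (chord Ω θ x)).toReal⁻¹ :=
    (measurable_volume_chord hΩ θ).ennreal_toReal.inv.stronglyMeasurable
  set G : F × ℝ → ℝ := S.indicator fun p : F × ℝ => (volume (chord Ω θ p.1)).toReal⁻¹ *
    f (p.1 + p.2 • θ) with hG
  set K : F × ℝ → ℝ := S.indicator fun p : F × ℝ => (volume (chord Ω θ p.1)).toReal⁻¹ * f p.1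
    with hK
  have hKm : StronglyMeasurable K :=
    ((hV.comp_measurable measurable_fst).mul (hf.comp_measurable measurable_fst)).indicator hS
  have hempty : ∀ x ∉ Ω, chord Ω θ x = ∅ := fun x hx =>
    eq_empty_of_forall_notMem fun t ht => hx (mem_of_mem_chord ht)
  have hGK : ∀ p, G (shear θ p) = K p := by
    intro p
    by_cases hp : p ∈ S
    · have hp' : shear θ p ∈ S := neg_mem_chord_add_smul hp
      rw [hG, hK, indicator_of_mem hp, indicator_of_mem hp']
      change (volume (chord Ω θ (p.1 + p.2 • θ))).toReal⁻¹ * f (p.1 + p.2 • θ + (-p.2) • θ) = _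
      rw [volume_chord_add_smul hp]
      simp [add_assoc]
    · have hp' : shear θ p ∉ S := fun h => hp (neg_mem_chord_add_smul_iff.1 h)
      rw [hG, hK, indicator_of_notMem hp, indicator_of_notMem hp']
  have hKx : ∀ x t, K (x, t) =
      (chord Ω θ x).indicator (fun _ => (volume (chord Ω θ x)).toReal⁻¹ * f x) t := fun x t => rfl
  have hGx : ∀ x t, G (x, t) =
      (chord Ω θ x).indicator (fun t => (volume (chord Ω θ x)).toReal⁻¹ * f (x + t • θ)) t :=
    fun x t => rfl
  have hKint : ∀ x, ∫ t, K (x, t) = Ω.indicator f x := by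
    intro x
    simp_rw [hKx]
    rw [integral_indicator (isOpen_chord hΩ θ x).measurableSet, setIntegral_const]
    by_cases hx : x ∈ Ω
    · have h0 : (volume (chord Ω θ x)).toReal ≠ 0 := (ENNReal.toReal_pos
        (volume_chord_ne_zero hΩ hr hθ hx) (volume_chord_ne_top hΩ hr hθ hx)).ne'
      rw [indicator_of_mem hx, measureReal_def, smul_eq_mul, mul_inv_cancel_left₀ h0]
    · rw [indicator_of_notMem hx]
      simp [hempty x hx]
  have hGint : ∀ x, ∫ t, G (x, t) = Ω.indicator (fun x => (volume (chord Ω θ x)).toReal⁻¹ *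
      ∫ t in chord Ω θ x, f (x + t • θ)) x := by
    intro x
    simp_rw [hGx]
    rw [integral_indicator (isOpen_chord hΩ θ x).measurableSet, integral_const_mul]
    by_cases hx : x ∈ Ω
    · rw [indicator_of_mem hx]
    · rw [indicator_of_notMem hx]
      simp [hempty x hx]
  -- Integrability is checked on `K`, which is constant in `t` on each chord, and carried over to
  -- `G` by the shear.
  have hKi : Integrable K ((volume : Measure F).prod (volume : Measure ℝ)) := by
    rw [integrable_prod_iff hKm.aestronglyMeasurable]
    constructor
    · refine Eventually.of_forall fun x => ?_
      simp_rw [hKx]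
      rw [integrable_indicator_iff (isOpen_chord hΩ θ x).measurableSet]
      by_cases hx : x ∈ Ω
      · exact integrableOn_const (volume_chord_ne_top hΩ hr hθ hx)
      · simp [hempty x hx]
    · have : (fun x => ∫ t, ‖K (x, t)‖) = Ω.indicator (fun x => ‖f x‖) := by
        ext x
        simp_rw [hKx, norm_indicator_eq_indicator_norm]
        rw [integral_indicator (isOpen_chord hΩ θ x).measurableSet, setIntegral_const]
        by_cases hx : x ∈ Ω
        · have h0 := ENNReal.toReal_pos
            (volume_chord_ne_zero hΩ hr hθ hx) (volume_chord_ne_top hΩ hr hθ hx)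
          rw [indicator_of_mem hx, measureReal_def, smul_eq_mul, norm_mul, norm_inv,
            Real.norm_of_nonneg h0.le, mul_inv_cancel_left₀ h0.ne']
        · rw [indicator_of_notMem hx]
          simp [hempty x hx]
      rw [this, integrable_indicator_iff hΩ.measurableSet]
      exact hi.norm
  have hcomp : G ∘ shear θ = K := funext hGK
  have hGi : Integrable G ((volume : Measure F).prod (volume : Measure ℝ)) := by
    rw [← (measurePreserving_shear θ).integrable_comp_emb (shear θ).measurableEmbedding, hcomp]
    exact hKi
  have hGK' : ∫ p, G p ∂((volume : Measure F).prod (volume : Measure ℝ)) =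
      ∫ p, K p ∂((volume : Measure F).prod (volume : Measure ℝ)) := by
    rw [← hcomp]
    exact ((measurePreserving_shear θ).integral_comp (shear θ).measurableEmbedding G).symm
  constructor
  · rw [← integrable_indicator_iff hΩ.measurableSet]
    have := hGi.integral_prod_left
    simp_rw [hGint] at this
    exact this
  · rw [integral_prod _ hGi, integral_prod _ hKi] at hGK'
    simp_rw [hGint, hKint] at hGK'
    rwa [integral_indicator hΩ.measurableSet, integral_indicator hΩ.measurableSet] at hGK'

end ChordIntegral

/-! ### Absolute continuity along chords -/

/-- The product rule for absolutely continuous functions, applied to the primitives of `p` and `q`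
with values `A` and `B` at `c`. -/
theorem integral_primitive_mul_add {p q : ℝ → ℝ} {a b c : ℝ} (hc : c ∈ uIcc a b)
    (hp : IntervalIntegrable p volume a b) (hq : IntervalIntegrable q volume a b) (A B : ℝ) :
    ∫ t in a..b, ((A + ∫ τ in c..t, p τ) * q t + (B + ∫ τ in c..t, q τ) * p t) =
      (A + ∫ τ in c..b, p τ) * (B + ∫ τ in c..b, q τ) -
      (A + ∫ τ in c..a, p τ) * (B + ∫ τ in c..a, q τ) := by
  have hconst : ∀ C : ℝ, AbsolutelyContinuousOnInterval (fun _ : ℝ => C) a b := fun C =>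
    (LipschitzWith.const C).lipschitzOnWith.absolutelyContinuousOnInterval
  have hP := (hconst A).add (hp.absolutelyContinuousOnInterval_intervalIntegral hc)
  have hQ := (hconst B).add (hq.absolutelyContinuousOnInterval_intervalIntegral hc)
  have key := hP.integral_deriv_mul_eq_sub hQ
  simp only [Pi.add_apply] at key
  rw [← key]
  refine intervalIntegral.integral_congr_ae ?_
  filter_upwards [hp.ae_hasDerivAt_integral, hq.ae_hasDerivAt_integral] with t h1 h2 ht
  have ht' := uIoc_subset_uIcc ht
  have d1 := ((hasDerivAt_const t A).add (h1 ht' c hc)).deriv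
  have d2 := ((hasDerivAt_const t B).add (h2 ht' c hc)).deriv
  rw [d1, d2]
  ring

theorem mul_integral_unitInterval (f : ℝ → ℝ) (t : ℝ) :
    ∫ σ in (0 : ℝ)..1, t * f (σ * t) = ∫ τ in (0 : ℝ)..t, f τ := by
  rw [intervalIntegral.integral_const_mul, intervalIntegral.mul_integral_comp_mul_right]
  simp

section ACL

variable {F : Type*} [NormedAddCommGroup F] [InnerProductSpace ℝ F]

theorem IsTestFunction.comp_sub {Ω : Set F} {φ : F → ℝ} (hφ : ContDiff ℝ ∞ φ)
    (hc : HasCompactSupport φ) (a : F) (h : ∀ x ∈ tsupport φ, x + a ∈ Ω) :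
    IsTestFunction Ω fun x => φ (x - a) := by
  refine ⟨hφ.comp (contDiff_id.sub contDiff_const), ?_, ?_⟩
  · exact hc.comp_homeomorph (Homeomorph.subRight a)
  · intro x hx
    have : x - a ∈ tsupport φ :=
      tsupport_comp_subset_preimage φ (f := fun x => x - a) (by fun_prop) hx
    simpa using h _ this

variable [FiniteDimensional ℝ F] [MeasureSpace F] [BorelSpace F]

/-- The substitution `τ = σt` moves the variable endpoint into the integrand, leaving a parameter
integral over a fixed interval. -/
theorem stronglyMeasurable_integral_line {f : F → ℝ} (hf : StronglyMeasurable f) (θ : F) :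
    StronglyMeasurable fun p : F × ℝ => ∫ τ in (0 : ℝ)..p.2, f (p.1 + τ • θ) := by
  have e : (fun p : F × ℝ => ∫ τ in (0 : ℝ)..p.2, f (p.1 + τ • θ)) =
      fun p => ∫ σ in Ioc (0 : ℝ) 1, p.2 * f (p.1 + (σ * p.2) • θ) := by
    ext p
    rw [← intervalIntegral.integral_of_le zero_le_one,
      mul_integral_unitInterval (fun τ => f (p.1 + τ • θ))]
  rw [e]
  refine StronglyMeasurable.integral_prod_right'
    (f := fun z : (F × ℝ) × ℝ => z.1.2 * f (z.1.1 + (z.2 * z.1.2) • θ)) ?_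
  exact (measurable_snd.comp measurable_fst).stronglyMeasurable.mul
    (hf.comp_measurable (by fun_prop))

variable [(volume : Measure F).IsAddHaarMeasure] {Ω : Set F} {u w : F → ℝ} {θ : F}

theorem integrable_comp_translate {f : F → ℝ} (hf : Integrable f) (θ : F) (t : ℝ) :
    Integrable (fun p : F × ℝ => f (p.1 + (p.2 * t) • θ))
      ((volume : Measure F).prod (volume.restrict (Ioc (0 : ℝ) 1))) := by
  have h : MeasurePreserving (fun p : ℝ × F => (p.1, p.2 + (p.1 * t) • θ))
      ((volume.restrict (Ioc (0 : ℝ) 1)).prod (volume : Measure F))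
      ((volume.restrict (Ioc (0 : ℝ) 1)).prod (volume : Measure F)) := by
    refine (MeasurePreserving.id _).skew_product
      (g := fun s x => x + (s * t) • θ) (by fun_prop) ?_
    exact Eventually.of_forall fun s => map_add_right_eq_self _ _
  exact ((Measure.measurePreserving_swap.comp h).comp
    Measure.measurePreserving_swap).integrable_comp_of_integrable (hf.comp_fst _)

/-- For fixed `t`, the points whose segment to `x + tθ` stays in `Ω` form an open set. A test
function supported there remains one on `Ω` when slid along the segment, so its own fundamental
theorem of calculus passes to `u` by duality, and the fundamental lemma of the calculus of
variations concludes. The null set still depends on `t`. -/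
theorem HasWeakDirDeriv.ae_sub_eq_integral (h : HasWeakDirDeriv Ω u w θ) (hΩ : IsOpen Ω)
    (hu : IntegrableOn u Ω) (hw : IntegrableOn w Ω) (t : ℝ) :
    ∀ᵐ x, t ∈ chord Ω θ x → u (x + t • θ) = u x + ∫ τ in (0 : ℝ)..t, w (x + τ • θ) := by
  -- Extension by zero allows translation of the variable over the whole space.
  set u₀ := Ω.indicator u with hu₀
  set w₀ := Ω.indicator w with hw₀
  have hui : Integrable u₀ := (integrable_indicator_iff hΩ.measurableSet).2 hu
  have hwi : Integrable w₀ := (integrable_indicator_iff hΩ.measurableSet).2 hw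
  have hWi := integrable_comp_translate hwi θ t
  set I : Measure ℝ := volume.restrict (Ioc (0 : ℝ) 1)
  have h0 : ∀ φ : F → ℝ, IsTestFunction Ω φ →
      ∫ x, u₀ x * fderiv ℝ φ x θ = - ∫ x, w₀ x * φ x := by
    intro φ hφ
    have := h φ hφ
    rw [← integral_indicator hΩ.measurableSet, ← integral_indicator hΩ.measurableSet] at this
    simpa only [hu₀, hw₀, indicator_mul_left] using this
  have key : ∀ᵐ x, x ∈ {x | t ∈ chord Ω θ x} →
      u₀ (x + t • θ) - u₀ x - t * ∫ σ, w₀ (x + (σ * t) • θ) ∂I = 0 := by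
    refine (isOpen_mem_chord hΩ θ t).ae_eq_zero_of_integral_contDiff_smul_eq_zero ?_ ?_
    · refine Integrable.locallyIntegrable ?_ |>.locallyIntegrableOn _
      exact ((hui.comp_add_right (t • θ)).sub hui).sub (hWi.integral_prod_left.const_mul t)
    intro φ hφ hc hs
    obtain ⟨C, hC⟩ := hc.exists_bound_of_continuous hφ.continuous
    have hdc : Continuous fun x => fderiv ℝ φ x θ :=
      (hφ.continuous_fderiv (by simp)).clm_apply continuous_const
    obtain ⟨C', hC'⟩ := (hc.fderiv_apply ℝ θ).exists_bound_of_continuous hdc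
    have hφm : AEStronglyMeasurable φ (volume : Measure F) := hφ.continuous.aestronglyMeasurable
    have i₁ : Integrable fun x => u₀ (x + t • θ) * φ x :=
      (hui.comp_add_right (t • θ)).mul_bdd hφm (Eventually.of_forall hC)
    have i₂ : Integrable fun x => u₀ x * φ x := hui.mul_bdd hφm (Eventually.of_forall hC)
    have i₂' : Integrable fun x => u₀ x * φ (x - t • θ) :=
      hui.mul_bdd (by fun_prop) (Eventually.of_forall fun x => hC _)
    have i₃ : Integrable fun x => (∫ σ, w₀ (x + (σ * t) • θ) ∂I) * φ x :=
      hWi.integral_prod_left.mul_bdd hφm (Eventually.of_forall hC)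
    have ftc : ∀ x, φ (x - t • θ) - φ x = -t * ∫ σ, fderiv ℝ φ (x - (σ * t) • θ) θ ∂I := by
      intro x
      rw [← intervalIntegral.integral_of_le zero_le_one, ← intervalIntegral.integral_const_mul,
        intervalIntegral.integral_eq_sub_of_hasDerivAt (f := fun σ : ℝ => φ (x - (σ * t) • θ))]
      · simp
      · intro σ _
        have h1 : HasDerivAt (fun σ : ℝ => x - (σ * t) • θ) (-(t • θ)) σ := by
          simpa using (((hasDerivAt_id σ).mul_const t).smul_const θ).const_sub x
        have h2 := ((hφ.differentiable (by simp)) (x - (σ * t) • θ)).hasFDerivAt.comp_hasDerivAt σ h1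
        simpa [Function.comp_def] using h2
      · exact (Continuous.intervalIntegrable (by fun_prop) _ _)
    have swap₁ : ∫ x, u₀ x * ∫ σ, fderiv ℝ φ (x - (σ * t) • θ) θ ∂I =
        ∫ σ, (∫ x, u₀ x * fderiv ℝ φ (x - (σ * t) • θ) θ) ∂I := by
      simp_rw [← integral_const_mul]
      refine integral_integral_swap ?_
      exact (hui.comp_fst I).mul_bdd (Continuous.aestronglyMeasurable (by fun_prop))
        (Eventually.of_forall fun p => hC' _)
    have swap₂ : ∫ x, (∫ σ, w₀ (x + (σ * t) • θ) ∂I) * φ x =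
        ∫ σ, (∫ x, w₀ (x + (σ * t) • θ) * φ x) ∂I := by
      simp_rw [← integral_mul_const]
      refine integral_integral_swap ?_
      exact hWi.mul_bdd (Continuous.aestronglyMeasurable (by fun_prop))
        (Eventually.of_forall fun p => hC _)
    -- The weak derivative is tested against the translate of `φ` by `σtθ`; the support condition on
    -- `φ` keeps that translate inside `Ω` for every `σ` in the unit interval.
    have inner : ∀ σ ∈ Ioc (0 : ℝ) 1, ∫ x, u₀ x * fderiv ℝ φ (x - (σ * t) • θ) θ =
        - ∫ x, w₀ (x + (σ * t) • θ) * φ x := by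
      intro σ hσ
      have ht : IsTestFunction Ω fun x => φ (x - (σ * t) • θ) :=
        IsTestFunction.comp_sub hφ hc _ fun x hx =>
          mem_chord_iff_unitInterval.1 (hs hx) σ (Ioc_subset_Icc_self hσ)
      have := h0 _ ht
      simp_rw [fderiv_comp_sub] at this
      rw [this, ← integral_add_right_eq_self (fun x => w₀ x * φ (x - (σ * t) • θ)) ((σ * t) • θ)]
      simp
    have inner' : ∫ σ, (∫ x, u₀ x * fderiv ℝ φ (x - (σ * t) • θ) θ) ∂I =
        - ∫ σ, (∫ x, w₀ (x + (σ * t) • θ) * φ x) ∂I := by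
      rw [← integral_neg]
      exact setIntegral_congr_fun measurableSet_Ioc inner
    have shift : ∫ x, u₀ (x + t • θ) * φ x = ∫ x, u₀ x * φ (x - t • θ) := by
      rw [← integral_add_right_eq_self (fun x => u₀ x * φ (x - t • θ)) (t • θ)]
      simp
    calc ∫ x, φ x • (u₀ (x + t • θ) - u₀ x - t * ∫ σ, w₀ (x + (σ * t) • θ) ∂I)
        = ∫ x, (u₀ (x + t • θ) * φ x - u₀ x * φ x -
            t * ((∫ σ, w₀ (x + (σ * t) • θ) ∂I) * φ x)) := by
          refine integral_congr_ae (Eventually.of_forall fun x => ?_)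
          simp only [smul_eq_mul]; ring
      _ = (∫ x, u₀ x * φ (x - t • θ)) - (∫ x, u₀ x * φ x) -
            t * ∫ x, (∫ σ, w₀ (x + (σ * t) • θ) ∂I) * φ x := by
          rw [integral_sub (f := fun x => u₀ (x + t • θ) * φ x - u₀ x * φ x) (i₁.sub i₂)
            (i₃.const_mul t), integral_sub i₁ i₂, shift,
            integral_const_mul]
      _ = (∫ x, -t * (u₀ x * ∫ σ, fderiv ℝ φ (x - (σ * t) • θ) θ ∂I)) -
            t * ∫ x, (∫ σ, w₀ (x + (σ * t) • θ) ∂I) * φ x := by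
          rw [← integral_sub i₂' i₂]
          congr 1
          refine integral_congr_ae (Eventually.of_forall fun x => ?_)
          simp only
          rw [← mul_sub, ftc x]; ring
      _ = 0 := by
          rw [integral_const_mul, swap₁, inner', swap₂]; ring
  filter_upwards [key] with x hx ht
  have h1 := hx ht
  rw [hu₀, indicator_of_mem (add_smul_mem_of_mem_chord ht), indicator_of_mem (mem_of_mem_chord ht)]
    at h1
  have h2 : ∫ σ, w₀ (x + (σ * t) • θ) ∂I = ∫ σ, w (x + (σ * t) • θ) ∂I :=
    setIntegral_congr_fun measurableSet_Ioc fun σ hσ =>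
      indicator_of_mem (mem_chord_iff_unitInterval.1 ht σ (Ioc_subset_Icc_self hσ)) _
  rw [h2, ← intervalIntegral.integral_of_le zero_le_one, ← intervalIntegral.integral_const_mul,
    mul_integral_unitInterval (fun τ => w (x + τ • θ))] at h1
  linarith

/-- Fubini exchanges "for every `t`, a.e. `x`" for "for a.e. `x`, a.e. `t`", which removes the
dependence of the exceptional set on `t`. -/
theorem HasWeakDirDeriv.ae_ae_eq_add_integral (h : HasWeakDirDeriv Ω u w θ) (hΩ : IsOpen Ω)
    (hum : StronglyMeasurable u) (hwm : StronglyMeasurable w)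
    (hu : IntegrableOn u Ω) (hw : IntegrableOn w Ω) :
    ∀ᵐ x, ∀ᵐ t : ℝ, t ∈ chord Ω θ x →
      u (x + t • θ) = u x + ∫ τ in (0 : ℝ)..t, w (x + τ • θ) := by
  rw [Measure.ae_ae_comm]
  · exact Eventually.of_forall fun t => h.ae_sub_eq_integral hΩ hu hw t
  · have e : {p : F × ℝ | p.2 ∈ chord Ω θ p.1 →
        u (p.1 + p.2 • θ) = u p.1 + ∫ τ in (0 : ℝ)..p.2, w (p.1 + τ • θ)} =
        {p : F × ℝ | p.2 ∈ chord Ω θ p.1}ᶜ ∪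
        {p | u (p.1 + p.2 • θ) = u p.1 + ∫ τ in (0 : ℝ)..p.2, w (p.1 + τ • θ)} := by
      ext p
      simp only [mem_ofPred_eq, mem_union, mem_compl_iff]
      tauto
    rw [e]
    refine (isOpen_chord_prod hΩ θ).measurableSet.compl.union (StronglyMeasurable.measurableSet_eq_fun
      (hum.comp_measurable (by fun_prop)) ?_)
    exact (hum.comp_measurable measurable_fst).add (stronglyMeasurable_integral_line hwm θ)

end ACL

/-! ### Boundary values along chords -/

section ChordMemLp

variable {F : Type*} [NormedAddCommGroup F] [NormedSpace ℝ F] {Ω : Set F} {θ : F} {w : F → ℝ}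

theorem intervalIntegrable_of_memLp_chord (hΩ : IsOpen Ω) {r : ℝ}
    (hr : Ω ⊆ Metric.closedBall 0 r) (hθ : ‖θ‖ = 1) {x : F} (hx : x ∈ Ω)
    (h : MemLp (fun t : ℝ => w (x + t • θ)) 2 (volume.restrict (chord Ω θ x))) :
    IntervalIntegrable (fun t : ℝ => w (x + t • θ)) volume
      (-exitTime Ω (-θ) x) (exitTime Ω θ x) := by
  have h1 := (exitTime_spec hΩ hr hθ hx).1
  have h2 := (exitTime_spec hΩ hr (θ := -θ) (by simpa using hθ) hx).1
  have : IsFiniteMeasure (volume.restrict (chord Ω θ x)) :=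
    ⟨by simpa using (volume_chord_ne_top hΩ hr hθ hx).lt_top⟩
  rw [intervalIntegrable_iff_integrableOn_Ioo_of_le (by linarith), ← chord_eq_Ioo hΩ hr hθ hx]
  exact h.integrable (by norm_num)

/-- Cauchy–Schwarz on the part of the chord ahead of `x`. The right-hand side keeps the whole chord,
to match the averages in `lintegral_chord`. -/
theorem enorm_integral_exitTime_sq_le (hΩ : IsOpen Ω) {r : ℝ}
    (hr : Ω ⊆ Metric.closedBall 0 r) (hθ : ‖θ‖ = 1) {x : F} (hx : x ∈ Ω)
    (hw : AEStronglyMeasurable (fun t : ℝ => w (x + t • θ)) (volume.restrict (chord Ω θ x))) :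
    ‖∫ τ in (0 : ℝ)..exitTime Ω θ x, w (x + τ • θ)‖ₑ ^ (2 : ℝ) ≤
      volume (chord Ω θ x) * ∫⁻ t in chord Ω θ x, ‖w (x + t • θ)‖ₑ ^ (2 : ℝ) := by
  have h1 := (exitTime_spec hΩ hr hθ hx).1
  have h2 := (exitTime_spec hΩ hr (θ := -θ) (by simpa using hθ) hx).1
  have hsub : Ioo 0 (exitTime Ω θ x) ⊆ chord Ω θ x := by
    rw [chord_eq_Ioo hΩ hr hθ hx]
    exact Ioo_subset_Ioo_left (by linarith)
  have e1 : ‖∫ τ in (0 : ℝ)..exitTime Ω θ x, w (x + τ • θ)‖ₑ ≤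
      eLpNorm (fun t : ℝ => w (x + t • θ)) 1 (volume.restrict (chord Ω θ x)) := by
    rw [intervalIntegral.integral_of_le h1.le, integral_Ioc_eq_integral_Ioo,
      eLpNorm_one_eq_lintegral_enorm]
    exact (enorm_integral_le_lintegral_enorm _).trans (lintegral_mono_set hsub)
  have e2 := eLpNorm_le_eLpNorm_mul_rpow_measure_univ (p := 1) (q := 2) (by norm_num) hw
  have e3 := ENNReal.rpow_le_rpow (e1.trans e2) (zero_le_two (α := ℝ))
  refine e3.trans (le_of_eq ?_)
  rw [ENNReal.mul_rpow_of_nonneg _ _ zero_le_two, mul_comm, Measure.restrict_apply_univ,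
    ← ENNReal.rpow_mul]
  have := eLpNorm_nnreal_pow_eq_lintegral (f := fun t : ℝ => w (x + t • θ))
    (μ := volume.restrict (chord Ω θ x)) (p := 2) (by norm_num)
  norm_num at this ⊢
  rw [this]

end ChordMemLp

/-! ### End values and the trace inequality -/

section EndVal

/-- Needed on the whole space, because `Φ_{-θ}` is also evaluated at boundary points, where the exit
time need not be semicontinuous. Exhausting the open parameter interval by compact ones writes each
superlevel set by countably many open sets. -/
theorem measurable_exitTime {F : Type*} [NormedAddCommGroup F] [NormedSpace ℝ F]
    [MeasurableSpace F] [BorelSpace F] {Ω : Set F} (hΩ : IsOpen Ω)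
    (hb : Bornology.IsBounded Ω) {θ : F} (hθ : ‖θ‖ = 1) : Measurable (exitTime Ω θ) := by
  obtain ⟨r, hr⟩ := hb.subset_closedBall 0
  have hbdd : ∀ z : F, BddAbove {s : ℝ | 0 ≤ s ∧ ∀ t ∈ Ioo 0 s, z + t • θ ∈ Ω} := by
    refine fun z => ⟨max 0 (r + ‖z‖), fun s hs => ?_⟩
    refine le_of_forall_lt fun t ht => ?_
    by_contra! hcon
    obtain ⟨t', h2, h3⟩ := exists_between ht
    have h4 : ‖z + t' • θ‖ ≤ r := by
      simpa using hr (hs.2 t' ⟨(le_max_left _ _).trans_lt (hcon.trans_lt h2), h3⟩)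
    have h5 : ‖t' • θ‖ ≤ ‖z + t' • θ‖ + ‖z‖ := by
      simpa using norm_sub_le (z + t' • θ) z
    rw [norm_smul, hθ, mul_one, Real.norm_eq_abs] at h5
    have := le_abs_self t'
    have := le_max_right 0 (r + ‖z‖)
    linarith
  have hopen : ∀ a b : ℝ, IsOpen {z : F | ∀ t ∈ Icc a b, z + t • θ ∈ Ω} := by
    intro a b
    rw [isOpen_iff_eventually]
    intro z hz
    refine isCompact_Icc.eventually_forall_of_forall_eventually fun t ht => ?_
    have hc : Continuous fun p : F × ℝ => p.1 + p.2 • θ := by fun_prop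
    exact hc.continuousAt.eventually_mem (hΩ.mem_nhds (hz t ht))
  refine measurable_of_Ioi fun c => ?_
  rcases lt_or_ge c 0 with hc | hc
  · convert MeasurableSet.univ
    refine eq_univ_of_forall fun z => hc.trans_le (Real.sSup_nonneg fun s hs => hs.1)
  · have e : exitTime Ω θ ⁻¹' Ioi c = ⋃ n : ℕ, ⋂ k : ℕ,
        {z : F | ∀ t ∈ Icc (1 / ((k : ℝ) + 1)) (c + 1 / ((n : ℝ) + 1)), z + t • θ ∈ Ω} := by
      ext z
      simp only [mem_preimage, mem_Ioi, mem_iUnion, mem_iInter, mem_ofPred_eq]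
      constructor
      · intro h
        obtain ⟨s, hs, hcs⟩ := exists_lt_of_lt_csSup
          (s := {s : ℝ | 0 ≤ s ∧ ∀ t ∈ Ioo 0 s, z + t • θ ∈ Ω}) ⟨0, le_rfl, by simp⟩ h
        obtain ⟨n, hn⟩ := exists_nat_one_div_lt (sub_pos.2 hcs)
        refine ⟨n, fun k t ht => hs.2 t ⟨lt_of_lt_of_le (by positivity) ht.1, ?_⟩⟩
        linarith [ht.2]
      · rintro ⟨n, hn⟩
        have hpos : (0 : ℝ) < 1 / ((n : ℝ) + 1) := by positivity
        refine (lt_add_of_pos_right c hpos).trans_le (le_csSup (hbdd z) ⟨by linarith, ?_⟩)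
        intro t ht
        obtain ⟨k, hk⟩ := exists_nat_one_div_lt ht.1
        exact hn k t ⟨hk.le, ht.2.le⟩
    rw [e]
    exact MeasurableSet.iUnion fun n => MeasurableSet.iInter fun k => (hopen _ _).measurableSet

variable {F : Type*} [NormedAddCommGroup F] [InnerProductSpace ℝ F] [FiniteDimensional ℝ F]
  [MeasureSpace F] [BorelSpace F]

/-- `u` is, near `x` on its chord, a primitive of the square integrable function `w`. -/
structure IsRegularAt (Ω : Set F) (θ : F) (u w : F → ℝ) (x : F) : Prop where
  memLp : MemLp (fun t : ℝ => w (x + t • θ)) 2 (volume.restrict (chord Ω θ x))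
  ae_eq : ∀ᵐ t : ℝ, t ∈ chord Ω θ x → u (x + t • θ) = u x + ∫ τ in (0 : ℝ)..t, w (x + τ • θ)

/-- The value at the exit point of the primitive of `w` along the chord that takes the value
`u x` at `x`. -/
def endVal (Ω : Set F) (θ : F) (u w : F → ℝ) (x : F) : ℝ :=
  u x + ∫ τ in (0 : ℝ)..exitTime Ω θ x, w (x + τ • θ)

variable {Ω : Set F} {θ : F} {u w : F → ℝ}

theorem measurable_lintegral_chord (hΩ : IsOpen Ω) (θ : F) {f : F → ℝ≥0∞} (hf : Measurable f) :
    Measurable fun x => ∫⁻ t in chord Ω θ x, f (x + t • θ) := by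
  have e : (fun x => ∫⁻ t in chord Ω θ x, f (x + t • θ)) = fun x => ∫⁻ t : ℝ,
      {p : F × ℝ | p.2 ∈ chord Ω θ p.1}.indicator (fun p => f (p.1 + p.2 • θ)) (x, t) := by
    ext x
    rw [← lintegral_indicator (isOpen_chord hΩ θ x).measurableSet]
    rfl
  rw [e]
  exact Measurable.lintegral_prod_right' ((hf.comp (by fun_prop)).indicator
    (isOpen_chord_prod hΩ θ).measurableSet)

theorem stronglyMeasurable_integral_exitTime (hΩ : IsOpen Ω) (hb : Bornology.IsBounded Ω)
    (hθ : ‖θ‖ = 1) (hw : StronglyMeasurable w) :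
    StronglyMeasurable fun x => ∫ τ in (0 : ℝ)..exitTime Ω θ x, w (x + τ • θ) :=
  (stronglyMeasurable_integral_line hw θ).comp_measurable
    (measurable_id.prodMk (measurable_exitTime hΩ hb hθ))

theorem stronglyMeasurable_endVal (hΩ : IsOpen Ω) (hb : Bornology.IsBounded Ω)
    (hθ : ‖θ‖ = 1) (hu : StronglyMeasurable u) (hw : StronglyMeasurable w) :
    StronglyMeasurable (endVal Ω θ u w) :=
  hu.add (stronglyMeasurable_integral_exitTime hΩ hb hθ hw)

variable [(volume : Measure F).IsAddHaarMeasure]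

/-- Every translate of a null set is null, so by Fubini almost every line misses it at almost every
parameter. -/
theorem ae_ae_chord (hΩ : MeasurableSet Ω) (θ : F) {p : F → Prop}
    (hp : ∀ᵐ x ∂(volume.restrict Ω), p x) :
    ∀ᵐ x, ∀ᵐ t : ℝ, t ∈ chord Ω θ x → p (x + t • θ) := by
  rw [ae_restrict_iff' hΩ] at hp
  set N := toMeasurable volume {x | ¬ (x ∈ Ω → p x)}
  have hN : MeasurableSet N := measurableSet_toMeasurable _ _
  have hN0 : volume N = 0 := by rw [measure_toMeasurable]; exact hp
  have h : ∀ᵐ x, ∀ᵐ t : ℝ, x + t • θ ∉ N := by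
    rw [Measure.ae_ae_comm]
    · refine Eventually.of_forall fun t => ?_
      rw [ae_iff]
      simp only [not_not]
      change volume ((fun x => x + t • θ) ⁻¹' N) = 0
      rw [measure_preimage_add_right, hN0]
    · exact (hN.preimage (by fun_prop : Measurable fun p : F × ℝ => p.1 + p.2 • θ)).compl
  filter_upwards [h] with x hx
  filter_upwards [hx] with t ht h1
  by_contra hcon
  exact ht (subset_toMeasurable _ _ fun h2 => hcon (h2 (add_smul_mem_of_mem_chord h1)))

/-- The chord averages of `|w|²` have finite integral over `Ω`, hence are finite almost everywhere.
-/
theorem ae_memLp_chord (hΩ : IsOpen Ω) (hb : Bornology.IsBounded Ω) (hθ : ‖θ‖ = 1)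
    (hwm : StronglyMeasurable w) (hw : MemLp w 2 (volume.restrict Ω)) :
    ∀ᵐ x ∂(volume.restrict Ω),
      MemLp (fun t : ℝ => w (x + t • θ)) 2 (volume.restrict (chord Ω θ x)) := by
  obtain ⟨r, hr⟩ := hb.subset_closedBall 0
  have hm : Measurable fun x => ‖w x‖ₑ ^ (2 : ℝ) := hwm.measurable.enorm.pow_const _
  have h := lintegral_chord hΩ hb hθ hm
  have hfin : ∫⁻ x in Ω, ‖w x‖ₑ ^ (2 : ℝ) < ⊤ := by
    simpa using lintegral_rpow_enorm_lt_top_of_eLpNorm_lt_top (by norm_num) (by norm_num) hw.2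
  have hae := ae_lt_top' ((measurable_volume_chord hΩ θ).inv.mul
    (measurable_lintegral_chord hΩ θ hm)).aemeasurable (h.trans_lt hfin).ne
  filter_upwards [hae, ae_restrict_mem hΩ.measurableSet] with x hx hxΩ
  refine ⟨(hwm.comp_measurable (by fun_prop)).aestronglyMeasurable, ?_⟩
  rw [eLpNorm_lt_top_iff_lintegral_rpow_enorm_lt_top (by norm_num) (by norm_num)]
  rw [ENNReal.toReal_ofNat]
  by_contra hcon
  rw [not_lt, top_le_iff] at hcon
  simp only [Pi.mul_apply, Pi.inv_apply, hcon] at hx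
  -- The chord has finite length, so the factor in front is nonzero and an infinite integral would
  -- make the average infinite.
  rw [ENNReal.mul_top (ENNReal.inv_ne_zero.2 (volume_chord_ne_top hΩ hr hθ hxΩ))] at hx
  exact lt_irrefl _ hx

theorem HasWeakDirDeriv.ae_isRegularAt (h : HasWeakDirDeriv Ω u w θ) (hΩ : IsOpen Ω)
    (hb : Bornology.IsBounded Ω) (hθ : ‖θ‖ = 1) (hum : StronglyMeasurable u)
    (hwm : StronglyMeasurable w) (hu : MemLp u 2 (volume.restrict Ω))
    (hw : MemLp w 2 (volume.restrict Ω)) :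
    ∀ᵐ x ∂(volume.restrict Ω), IsRegularAt Ω θ u w x := by
  have : IsFiniteMeasure (volume.restrict Ω) := ⟨by simpa using hb.measure_lt_top⟩
  filter_upwards [ae_memLp_chord hΩ hb hθ hwm hw, ae_restrict_of_ae
    (h.ae_ae_eq_add_integral hΩ hum hwm (hu.integrable (by norm_num)) (hw.integrable (by norm_num)))]
    with x h1 h2
  exact ⟨h1, h2⟩

theorem eLpNorm_integral_exitTime_le (hΩ : IsOpen Ω) {r : ℝ} (hr : Ω ⊆ Metric.closedBall 0 r)
    (hθ : ‖θ‖ = 1) (hwm : StronglyMeasurable w) :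
    eLpNorm (fun x => ∫ τ in (0 : ℝ)..exitTime Ω θ x, w (x + τ • θ)) 2 (volume.restrict Ω) ≤
      ENNReal.ofReal (4 * r) * eLpNorm w 2 (volume.restrict Ω) := by
  have hm : Measurable fun x => ‖w x‖ₑ ^ (2 : ℝ) := hwm.measurable.enorm.pow_const _
  have hb : Bornology.IsBounded Ω := Metric.isBounded_closedBall.subset hr
  have h := lintegral_chord hΩ hb hθ hm
  rw [← ENNReal.rpow_le_rpow_iff (zero_lt_two (α := ℝ)), ENNReal.mul_rpow_of_nonneg _ _ zero_le_two]
  have hp : ∀ f : F → ℝ, eLpNorm f 2 (volume.restrict Ω) ^ (2 : ℝ) =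
      ∫⁻ x in Ω, ‖f x‖ₑ ^ (2 : ℝ) := fun f => by
    simpa using eLpNorm_nnreal_pow_eq_lintegral (f := f)
      (μ := volume.restrict Ω) (p := 2) (by norm_num)
  have hmul : Measurable fun x => (volume (chord Ω θ x))⁻¹ *
      ∫⁻ t in chord Ω θ x, ‖w (x + t • θ)‖ₑ ^ (2 : ℝ) :=
    (measurable_volume_chord hΩ θ).inv.mul (measurable_lintegral_chord hΩ θ hm)
  rw [hp, hp, ← h, ← lintegral_const_mul _ hmul]
  refine setLIntegral_mono_ae' hΩ.measurableSet (Eventually.of_forall fun x hx => ?_)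
  refine (enorm_integral_exitTime_sq_le hΩ hr hθ hx
    (hwm.comp_measurable (by fun_prop)).aestronglyMeasurable).trans ?_
  rw [← mul_assoc]
  gcongr
  set V := volume (chord Ω θ x) with hV
  have h1 := (exitTime_spec hΩ hr hθ hx).2.1
  have h2 := (exitTime_spec hΩ hr (θ := -θ) (by simpa using hθ) hx).2.1
  -- Each of the two exit times is at most `2r`.
  have hVle : V ≤ ENNReal.ofReal (4 * r) := by
    rw [hV, volume_chord hΩ hr hθ hx]
    exact ENNReal.ofReal_le_ofReal (by linarith)
  have h0 := volume_chord_ne_zero hΩ hr hθ hx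
  have ht := volume_chord_ne_top hΩ hr hθ hx
  -- One factor `V⁻¹` is kept to form the chord average; the remaining `V²` is bounded by `(4r)²`.
  calc V = V ^ (2 : ℝ) * V⁻¹ := by
        rw [ENNReal.rpow_two, sq, mul_assoc, ENNReal.mul_inv_cancel h0 ht, mul_one]
    _ ≤ _ := by gcongr

theorem eLpNorm_endVal_le (hΩ : IsOpen Ω) {r : ℝ} (hr : Ω ⊆ Metric.closedBall 0 r)
    (hθ : ‖θ‖ = 1) (hum : StronglyMeasurable u) (hwm : StronglyMeasurable w) :
    eLpNorm (endVal Ω θ u w) 2 (volume.restrict Ω) ≤ eLpNorm u 2 (volume.restrict Ω) +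
      ENNReal.ofReal (4 * r) * eLpNorm w 2 (volume.restrict Ω) :=
  (eLpNorm_add_le hum.aestronglyMeasurable (stronglyMeasurable_integral_exitTime hΩ
    (Metric.isBounded_closedBall.subset hr) hθ hwm).aestronglyMeasurable (by norm_num)).trans
    (by gcongr; exact eLpNorm_integral_exitTime_le hΩ hr hθ hwm)

/-- Only almost everywhere: on a chord where some `wᵢ` is not integrable, the integral takes its
default value and additivity may fail. -/
theorem endVal_sub_ae (hΩ : IsOpen Ω) (hb : Bornology.IsBounded Ω) (hθ : ‖θ‖ = 1)
    {u₁ w₁ u₂ w₂ : F → ℝ} (hm₁ : StronglyMeasurable w₁) (hm₂ : StronglyMeasurable w₂)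
    (h₁ : MemLp w₁ 2 (volume.restrict Ω)) (h₂ : MemLp w₂ 2 (volume.restrict Ω)) :
    endVal Ω θ u₁ w₁ - endVal Ω θ u₂ w₂ =ᵐ[volume.restrict Ω]
      endVal Ω θ (u₁ - u₂) (w₁ - w₂) := by
  obtain ⟨r, hr⟩ := hb.subset_closedBall 0
  filter_upwards [ae_memLp_chord hΩ hb hθ hm₁ h₁, ae_memLp_chord hΩ hb hθ hm₂ h₂,
    ae_restrict_mem hΩ.measurableSet] with x k₁ k₂ hx
  have e1 := (exitTime_spec hΩ hr hθ hx).1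
  have e2 := (exitTime_spec hΩ hr (θ := -θ) (by simpa using hθ) hx).1
  have hsub : uIcc 0 (exitTime Ω θ x) ⊆ uIcc (-exitTime Ω (-θ) x) (exitTime Ω θ x) := by
    rw [uIcc_of_le e1.le, uIcc_of_le (by linarith)]
    exact Icc_subset_Icc_left (by linarith)
  have i₁ := (intervalIntegrable_of_memLp_chord hΩ hr hθ hx k₁).mono_set hsub
  have i₂ := (intervalIntegrable_of_memLp_chord hΩ hr hθ hx k₂).mono_set hsub
  simp only [endVal, Pi.sub_apply]
  rw [intervalIntegral.integral_sub i₁ i₂]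
  ring

end EndVal

/-! ### Integration by parts along chords -/

section ChordParts

variable {F : Type*} [NormedAddCommGroup F] [InnerProductSpace ℝ F]
  {Ω : Set F} {θ : F} {u w u' w' : F → ℝ} {x : F}

theorem endVal_neg (Ω : Set F) (θ : F) (u w : F → ℝ) (x : F) :
    endVal Ω (-θ) u (-w) x =
      u x + ∫ τ in (0 : ℝ)..(-exitTime Ω (-θ) x), w (x + τ • θ) := by
  have h := intervalIntegral.integral_comp_neg (a := 0) (b := exitTime Ω (-θ) x)
    (fun τ : ℝ => w (x + τ • θ))
  simp only [endVal, Pi.neg_apply, smul_neg, neg_smul] at h ⊢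
  rw [intervalIntegral.integral_neg, h, neg_zero, intervalIntegral.integral_symm, neg_neg]

/-- The product rule between the two ends of the chord. The rear end is the exit point in the
direction `-θ`, along which the derivative is `-w`. -/
theorem integral_chord_mul_add (hΩ : IsOpen Ω) (hb : Bornology.IsBounded Ω) (hθ : ‖θ‖ = 1)
    (hx : x ∈ Ω) (h : IsRegularAt Ω θ u w x) (h' : IsRegularAt Ω θ u' w' x) :
    ∫ t in chord Ω θ x, (u (x + t • θ) * w' (x + t • θ) + u' (x + t • θ) * w (x + t • θ)) =
      endVal Ω θ u w x * endVal Ω θ u' w' x -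
      endVal Ω (-θ) u (-w) x * endVal Ω (-θ) u' (-w') x := by
  obtain ⟨r, hr⟩ := hb.subset_closedBall 0
  have e1 := (exitTime_spec hΩ hr hθ hx).1
  have e2 := (exitTime_spec hΩ hr (θ := -θ) (by simpa using hθ) hx).1
  have h0 : (0 : ℝ) ∈ uIcc (-exitTime Ω (-θ) x) (exitTime Ω θ x) := by
    rw [uIcc_of_le (by linarith)]
    constructor <;> linarith
  rw [endVal_neg, endVal_neg, endVal, endVal, ← integral_primitive_mul_add h0
    (intervalIntegrable_of_memLp_chord hΩ hr hθ hx h.memLp)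
    (intervalIntegrable_of_memLp_chord hΩ hr hθ hx h'.memLp),
    intervalIntegral.integral_of_le (by linarith), integral_Ioc_eq_integral_Ioo,
    ← chord_eq_Ioo hΩ hr hθ hx]
  refine setIntegral_congr_ae (isOpen_chord hΩ θ x).measurableSet ?_
  filter_upwards [h.ae_eq, h'.ae_eq] with t h1 h2 ht
  rw [h1 ht, h2 ht]

theorem isRegularAt_of_contDiff (hΩ : IsOpen Ω) (hb : Bornology.IsBounded Ω) (hθ : ‖θ‖ = 1)
    (hx : x ∈ Ω) {φ : F → ℝ} (hφ : ContDiff ℝ ∞ φ) (hc : HasCompactSupport φ) :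
    IsRegularAt Ω θ φ (fun x => fderiv ℝ φ x θ) x := by
  obtain ⟨r, hr⟩ := hb.subset_closedBall 0
  have hdc : Continuous fun x => fderiv ℝ φ x θ :=
    (hφ.continuous_fderiv (by simp)).clm_apply continuous_const
  obtain ⟨C, hC⟩ := (hc.fderiv_apply ℝ θ).exists_bound_of_continuous hdc
  have : IsFiniteMeasure (volume.restrict (chord Ω θ x)) :=
    ⟨by simpa using (volume_chord_ne_top hΩ hr hθ hx).lt_top⟩
  refine ⟨MemLp.of_bound (Continuous.aestronglyMeasurable (by fun_prop)) C
    (Eventually.of_forall fun t => hC _), Eventually.of_forall fun t _ => ?_⟩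
  rw [intervalIntegral.integral_eq_sub_of_hasDerivAt (f := fun σ : ℝ => φ (x + σ • θ))]
  · simp
  · intro σ _
    have h1 : HasDerivAt (fun σ : ℝ => x + σ • θ) θ σ := by
      simpa using ((hasDerivAt_id σ).smul_const θ).const_add x
    exact ((hφ.differentiable (by simp)) (x + σ • θ)).hasFDerivAt.comp_hasDerivAt σ h1
  · exact Continuous.intervalIntegrable (by fun_prop) _ _

theorem endVal_of_isTestFunction (hΩ : IsOpen Ω) (hb : Bornology.IsBounded Ω) (hθ : ‖θ‖ = 1)
    (hx : x ∈ Ω) {φ : F → ℝ} (hφ : IsTestFunction Ω φ) :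
    endVal Ω θ φ (fun x => fderiv ℝ φ x θ) x = 0 := by
  obtain ⟨r, hr⟩ := hb.subset_closedBall 0
  have hdc : Continuous fun x => fderiv ℝ φ x θ :=
    (hφ.1.continuous_fderiv (by simp)).clm_apply continuous_const
  have h0 : φ (x + exitTime Ω θ x • θ) = 0 :=
    image_eq_zero_of_notMem_tsupport fun h => (exitTime_spec hΩ hr hθ hx).2.2.2 (hφ.2.2 h)
  rw [endVal, intervalIntegral.integral_eq_sub_of_hasDerivAt (f := fun σ : ℝ => φ (x + σ • θ))]
  · simp [h0]
  · intro σ _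
    have h1 : HasDerivAt (fun σ : ℝ => x + σ • θ) θ σ := by
      simpa using ((hasDerivAt_id σ).smul_const θ).const_add x
    exact ((hφ.1.differentiable (by simp)) (x + σ • θ)).hasFDerivAt.comp_hasDerivAt σ h1
  · exact Continuous.intervalIntegrable (by fun_prop) _ _

variable [FiniteDimensional ℝ F] [MeasureSpace F] [BorelSpace F]
  [(volume : Measure F).IsAddHaarMeasure]

/-- Converse of `HasWeakDirDeriv.ae_isRegularAt`: test functions vanish at both ends of every chord,
so the product rule has no boundary term, and averaging over chords gives the weak identity. Its use
is on line sections. -/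
theorem hasWeakDirDeriv_of_ae_isRegularAt (hΩ : IsOpen Ω) (hb : Bornology.IsBounded Ω)
    (hθ : ‖θ‖ = 1) (hum : StronglyMeasurable u) (hwm : StronglyMeasurable w)
    (hu : MemLp u 2 (volume.restrict Ω)) (hw : MemLp w 2 (volume.restrict Ω))
    (h : ∀ᵐ x ∂(volume.restrict Ω), IsRegularAt Ω θ u w x) : HasWeakDirDeriv Ω u w θ := by
  intro φ hφ
  have hdc : Continuous fun x => fderiv ℝ φ x θ :=
    (hφ.1.continuous_fderiv (by simp)).clm_apply continuous_const
  have hφc := hφ.1.continuous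
  have i₁ : IntegrableOn (fun x => u x * fderiv ℝ φ x θ) Ω := hu.integrable_mul (hφ.memLp_fderiv θ)
  have i₂ : IntegrableOn (fun x => φ x * w x) Ω := hφ.memLp.integrable_mul hw
  have key := (integral_chord hΩ hb hθ (f := fun x => u x * fderiv ℝ φ x θ + φ x * w x)
    ((hum.mul hdc.stronglyMeasurable).add (hφc.stronglyMeasurable.mul hwm)) (i₁.add i₂)).2
  rw [integral_add i₁ i₂, integral_eq_zero_of_ae] at key
  · simp_rw [mul_comm (w _)]
    linarith
  · filter_upwards [h, ae_restrict_mem hΩ.measurableSet] with x hx hxΩ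
    have := endVal_of_isTestFunction hΩ hb (θ := -θ) (by simpa using hθ) hxΩ hφ
    have e : (fun x => fderiv ℝ φ x (-θ)) = -fun x => fderiv ℝ φ x θ := by ext x; simp
    rw [e] at this
    rw [integral_chord_mul_add hΩ hb hθ hxΩ hx
      (isRegularAt_of_contDiff hΩ hb hθ hxΩ hφ.1 hφ.2.1), endVal_of_isTestFunction hΩ hb hθ hxΩ hφ, this]
    simp

end ChordParts

/-! ### Slicing in the direction `θ` -/

section Slicing

variable {d : ℕ}

instance (θ : Eu d) : (hypMeasure θ).IsAddHaarMeasure := by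
  unfold hypMeasure
  infer_instance

theorem inner_smul_add_hyp {θ : Eu d} (hθ : ‖θ‖ = 1) (s : ℝ) (y : Hyp θ) :
    inner ℝ θ (s • θ + (y : Eu d)) = s := by
  have h : inner ℝ θ (y : Eu d) = 0 := Submodule.mem_orthogonal_singleton_iff_inner_right.1 y.2
  rw [inner_add_right, inner_smul_right, real_inner_self_eq_norm_sq, hθ, h]
  simp

theorem inner_smul_add_proj {θ : Eu d} (hθ : ‖θ‖ = 1) (x : Eu d) :
    (inner ℝ θ x : ℝ) • θ + ((Hyp θ).orthogonalProjectionOnto x : Eu d) = x := by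
  have h := Submodule.starProjection_add_starProjection_orthogonal
    (K := Submodule.span ℝ {θ}) x
  rwa [Submodule.starProjection_unit_singleton ℝ hθ] at h

theorem proj_smul_add_hyp {θ : Eu d} (hθ : ‖θ‖ = 1) (s : ℝ) (y : Hyp θ) :
    (Hyp θ).orthogonalProjectionOnto (s • θ + (y : Eu d)) = y := by
  have h := inner_smul_add_proj hθ (s • θ + (y : Eu d))
  rw [inner_smul_add_hyp hθ] at h
  exact Subtype.ext (add_left_cancel h)

/-- The linear isomorphism `(y, s) ↦ sθ + y`. -/
def sliceEquiv {θ : Eu d} (hθ : ‖θ‖ = 1) : (Hyp θ × ℝ) ≃ₗ[ℝ] Eu d where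
  toFun p := p.2 • θ + (p.1 : Eu d)
  invFun x := ((Hyp θ).orthogonalProjectionOnto x, inner ℝ θ x)
  map_add' p q := by
    simp only [Prod.snd_add, Prod.fst_add, Submodule.coe_add, add_smul]
    abel
  map_smul' c p := by
    simp [smul_add, smul_smul]
  left_inv p := Prod.ext (proj_smul_add_hyp hθ _ _) (inner_smul_add_hyp hθ _ _)
  right_inv x := inner_smul_add_proj hθ x

/-- Uniqueness of Haar measure. Only null sets and finiteness are at stake, so the value of the
constant is irrelevant. -/
theorem exists_map_sliceEquiv {θ : Eu d} (hθ : ‖θ‖ = 1) : ∃ c : ℝ≥0∞, c ≠ ⊤ ∧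
    Measure.map (sliceEquiv hθ) ((hypMeasure θ).prod (volume : Measure ℝ)) =
      c • (volume : Measure (Eu d)) := by
  have := Measure.MapLinearEquiv.isAddHaarMeasure ((hypMeasure θ).prod (volume : Measure ℝ))
    (sliceEquiv hθ)
  exact ⟨_, ENNReal.coe_ne_top, Measure.isAddLeftInvariant_eq_smul _ _⟩

theorem measurable_sliceEquiv {θ : Eu d} (hθ : ‖θ‖ = 1) : Measurable (sliceEquiv hθ) := by
  change Measurable fun p : Hyp θ × ℝ => p.2 • θ + (p.1 : Eu d)
  fun_prop

theorem ae_ae_slice {θ : Eu d} (hθ : ‖θ‖ = 1) {p : Eu d → Prop} (h : ∀ᵐ x, p x) :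
    ∀ᵐ y : Hyp θ ∂(hypMeasure θ), ∀ᵐ s : ℝ, p (s • θ + (y : Eu d)) := by
  obtain ⟨c, -, hc⟩ := exists_map_sliceEquiv hθ
  have h1 : ∀ᵐ x ∂(Measure.map (sliceEquiv hθ) ((hypMeasure θ).prod (volume : Measure ℝ))), p x := by
    rw [hc]
    exact Measure.smul_absolutelyContinuous.ae_le h
  exact Measure.ae_ae_of_ae_prod (ae_of_ae_map (measurable_sliceEquiv hθ).aemeasurable h1)

theorem ae_proj_notMem {θ : Eu d} (hθ : ‖θ‖ = 1) {N : Set (Hyp θ)} (hN : hypMeasure θ N = 0) :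
    ∀ᵐ x : Eu d, (Hyp θ).orthogonalProjectionOnto x ∉ N := by
  have := Measure.MapLinearEquiv.isAddHaarMeasure ((hypMeasure θ).prod (volume : Measure ℝ))
    (sliceEquiv hθ)
  -- Uniqueness is used here in the opposite direction: Lebesgue measure is a multiple of the image
  -- measure, so null sets of the latter are Lebesgue null.
  rw [Measure.isAddLeftInvariant_eq_smul (volume : Measure (Eu d))
    (Measure.map (sliceEquiv hθ) ((hypMeasure θ).prod (volume : Measure ℝ)))]
  refine Measure.smul_absolutelyContinuous.ae_le ?_
  have hN' : ∀ᵐ y ∂(hypMeasure θ), y ∉ toMeasurable (hypMeasure θ) N := by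
    rw [ae_iff]
    simpa using hN
  have hmeas : MeasurableSet {x : Eu d | (Hyp θ).orthogonalProjectionOnto x ∉
      toMeasurable (hypMeasure θ) N} :=
    ((measurableSet_toMeasurable _ _).preimage
      (Hyp θ).orthogonalProjectionOnto.continuous.measurable).compl
  have h1 : ∀ᵐ x ∂(Measure.map (sliceEquiv hθ) ((hypMeasure θ).prod (volume : Measure ℝ))),
      (Hyp θ).orthogonalProjectionOnto x ∉ toMeasurable (hypMeasure θ) N := by
    rw [ae_map_iff (measurable_sliceEquiv hθ).aemeasurable hmeas]
    filter_upwards [Measure.quasiMeasurePreserving_fst.ae hN'] with p hp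
    have : (Hyp θ).orthogonalProjectionOnto (sliceEquiv hθ p) = p.1 := proj_smul_add_hyp hθ _ _
    rwa [this]
  filter_upwards [h1] with x hx hxN using hx (subset_toMeasurable _ _ hxN)

theorem measurableSet_lineSection {Ω : Set (Eu d)} (hΩ : MeasurableSet Ω) (θ y : Eu d) :
    MeasurableSet (lineSection Ω θ y) :=
  hΩ.preimage (by fun_prop : Measurable fun s : ℝ => s • θ + y)

theorem ae_memLp_slice {Ω : Set (Eu d)} (hΩ : MeasurableSet Ω) {θ : Eu d} (hθ : ‖θ‖ = 1)
    {f : Eu d → ℝ} (hfm : StronglyMeasurable f) (hf : MemLp f 2 (volume.restrict Ω)) :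
    ∀ᵐ y : Hyp θ ∂(hypMeasure θ), MemLp (fun s : ℝ => f (s • θ + (y : Eu d))) 2
      (volume.restrict (lineSection Ω θ y)) := by
  obtain ⟨c, hc, hmap⟩ := exists_map_sliceEquiv hθ
  have hm : Measurable (Ω.indicator fun x => ‖f x‖ₑ ^ (2 : ℝ)) :=
    (hfm.measurable.enorm.pow_const _).indicator hΩ
  have hfin : ∫⁻ x, Ω.indicator (fun x => ‖f x‖ₑ ^ (2 : ℝ)) x < ⊤ := by
    rw [lintegral_indicator hΩ]
    simpa using lintegral_rpow_enorm_lt_top_of_eLpNorm_lt_top (by norm_num) (by norm_num) hf.2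
  have h1 : ∫⁻ y, (∫⁻ s : ℝ, Ω.indicator (fun x => ‖f x‖ₑ ^ (2 : ℝ)) (sliceEquiv hθ (y, s)))
      ∂(hypMeasure θ) ≠ ⊤ := by
    have hm' : Measurable fun p => Ω.indicator (fun x => ‖f x‖ₑ ^ (2 : ℝ)) (sliceEquiv hθ p) :=
      hm.comp (measurable_sliceEquiv hθ)
    rw [← lintegral_prod _ hm'.aemeasurable, ← lintegral_map hm (measurable_sliceEquiv hθ), hmap,
      lintegral_smul_measure]
    exact ENNReal.mul_ne_top hc hfin.ne
  have h2 := ae_lt_top ((hm.comp (measurable_sliceEquiv hθ)).lintegral_prod_right') h1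
  filter_upwards [h2] with y hy
  refine ⟨(hfm.comp_measurable (by fun_prop)).aestronglyMeasurable, ?_⟩
  rw [eLpNorm_lt_top_iff_lintegral_rpow_enorm_lt_top (by norm_num) (by norm_num),
    ENNReal.toReal_ofNat, ← lintegral_indicator (measurableSet_lineSection hΩ θ y)]
  exact hy

end Slicing

/-! ### Directional traces as boundary values along chords -/

section DirTrace

variable {d : ℕ} {Ω : Set (Eu d)} {θ : Eu d} {u w g : Eu d → ℝ}

theorem measurable_Phi (hΩ : IsOpen Ω) (hb : Bornology.IsBounded Ω) (hθ : ‖θ‖ = 1) :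
    Measurable (Phi Ω θ) :=
  measurable_id.add ((measurable_exitTime hΩ hb hθ).smul_const θ)

theorem continuousOn_primitive_chord (hΩ : IsOpen Ω) (hb : Bornology.IsBounded Ω) (hθ : ‖θ‖ = 1)
    {x : Eu d} (hx : x ∈ Ω) (h : IsRegularAt Ω θ u w x) (s : ℝ) :
    ContinuousOn (fun τ => u x + ∫ t in (0 : ℝ)..(τ - s), w (x + t • θ))
      (Ioc (s - exitTime Ω (-θ) x) (s + exitTime Ω θ x)) := by
  obtain ⟨r, hr⟩ := hb.subset_closedBall 0
  have e1 := (exitTime_spec hΩ hr hθ hx).1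
  have e2 := (exitTime_spec hΩ hr (θ := -θ) (by simpa using hθ) hx).1
  have h0 : (0 : ℝ) ∈ uIcc (-exitTime Ω (-θ) x) (exitTime Ω θ x) := by
    rw [uIcc_of_le (by linarith)]
    constructor <;> linarith
  have hc := intervalIntegral.continuousOn_primitive_interval'
    (intervalIntegrable_of_memLp_chord hΩ hr hθ hx h.memLp) h0
  refine continuousOn_const.add (hc.comp (by fun_prop) fun τ hτ => ?_)
  rw [uIcc_of_le (by linarith)]
  constructor <;> linarith [hτ.1, hτ.2]

theorem ae_primitive_eq (hΩ : IsOpen Ω) (hb : Bornology.IsBounded Ω) (hθ : ‖θ‖ = 1)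
    {x y : Eu d} {s : ℝ} (hxy : x = s • θ + y) (hx : x ∈ Ω) (h : IsRegularAt Ω θ u w x) :
    ∀ᵐ τ : ℝ, τ ∈ Ioo (s - exitTime Ω (-θ) x) (s + exitTime Ω θ x) →
      u (τ • θ + y) = u x + ∫ t in (0 : ℝ)..(τ - s), w (x + t • θ) := by
  obtain ⟨r, hr⟩ := hb.subset_closedBall 0
  have := (measurePreserving_sub_right (volume : Measure ℝ) s).quasiMeasurePreserving.ae h.ae_eq
  filter_upwards [this] with τ hτ hmem
  rw [← hτ (by rw [chord_eq_Ioo hΩ hr hθ hx]; constructor <;> linarith [hmem.1, hmem.2]), hxy]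
  congr 1
  module

/-- On the component of the line through `x`, the continuous representative in the definition of the
trace and the primitive of `w` through `u x` agree a.e. Both are continuous up to the right
endpoint, so they agree there too. -/
theorem IsDirTrace.comp_Phi_ae_eq (h : IsDirTrace Ω θ u g) (hΩ : IsOpen Ω)
    (hb : Bornology.IsBounded Ω) (hθ : ‖θ‖ = 1)
    (hreg : ∀ᵐ x ∂(volume.restrict Ω), IsRegularAt Ω θ u w x) :
    ∀ᵐ x ∂(volume.restrict Ω), g (Phi Ω θ x) = endVal Ω θ u w x := by
  obtain ⟨r, hr⟩ := hb.subset_closedBall 0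
  obtain ⟨v, hv, A, hA, hn, ht⟩ := h
  filter_upwards [hreg, ae_restrict_of_ae (ae_ae_chord hΩ.measurableSet θ hv),
    ae_restrict_of_ae (ae_proj_notMem hθ hn), ae_restrict_mem hΩ.measurableSet] with x hx hvx hAx hxΩ
  obtain ⟨e1, -, e1', e1''⟩ := exitTime_spec hΩ hr hθ hxΩ
  obtain ⟨e2, -, e2', e2''⟩ := exitTime_spec hΩ hr (θ := -θ) (by simpa using hθ) hxΩ
  set y := (Hyp θ).orthogonalProjectionOnto x with hy
  set s : ℝ := inner ℝ θ x with hs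
  have hxy : x = s • θ + (y : Eu d) := (inner_smul_add_proj hθ x).symm
  have hyA : y ∈ A := by
    by_contra hcon
    exact hAx ⟨⟨x, hxΩ, rfl⟩, hcon⟩
  have hline : ∀ τ : ℝ, τ • θ + (y : Eu d) = x + (τ - s) • θ := fun τ => by
    rw [hxy]; module
  have hcomp : IsComponentInterval (lineSection Ω θ y) (s - exitTime Ω (-θ) x)
      (s + exitTime Ω θ x) := by
    refine ⟨by linarith, fun τ hτ => ?_, fun hcon => ?_, fun hcon => ?_⟩
    · change τ • θ + (y : Eu d) ∈ Ω
      rw [hline]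
      refine add_smul_mem_of_mem_chord ?_
      rw [chord_eq_Ioo hΩ hr hθ hxΩ]
      constructor <;> linarith [hτ.1, hτ.2]
    · change _ • θ + (y : Eu d) ∈ Ω at hcon
      rw [hline] at hcon
      refine e2'' ?_
      convert hcon using 2
      module
    · change _ • θ + (y : Eu d) ∈ Ω at hcon
      rw [hline, add_sub_cancel_left] at hcon
      exact e1'' hcon
  obtain ⟨f, hfc, hfv, hgf⟩ := (ht y hyA).2 _ _ hcomp
  have hPhi : Phi Ω θ x = (s + exitTime Ω θ x) • θ + (y : Eu d) := by
    rw [hline, add_sub_cancel_left]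
    rfl
  rw [hPhi, hgf]
  have hvx' := (measurePreserving_sub_right (volume : Measure ℝ) s).quasiMeasurePreserving.ae hvx
  have hae : f =ᵐ[volume.restrict (Ioc (s - exitTime Ω (-θ) x) (s + exitTime Ω θ x))]
      fun τ => u x + ∫ t in (0 : ℝ)..(τ - s), w (x + t • θ) := by
    rw [← restrict_Ioo_eq_restrict_Ioc]
    filter_upwards [hfv, ae_restrict_of_ae hvx', ae_restrict_of_ae
      (ae_primitive_eq hΩ hb hθ hxy hxΩ hx), ae_restrict_mem measurableSet_Ioo] with τ h1 h2 h3 h4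
    rw [h1, ← h3 h4, hline]
    refine h2 ?_
    rw [chord_eq_Ioo hΩ hr hθ hxΩ]
    constructor <;> linarith [h4.1, h4.2]
  have := Measure.eqOn_Ioc_of_ae_eq volume hae hfc
    (continuousOn_primitive_chord hΩ hb hθ hxΩ hx s)
    (right_mem_Ioc.2 (by linarith))
  rw [this, endVal]
  simp

/-- Lets the theory of chords be applied to the section itself, an open set of the line with
direction `1`. -/
theorem chord_lineSection (Ω : Set (Eu d)) (θ y : Eu d) (s : ℝ) :
    chord (lineSection Ω θ y) (1 : ℝ) s = chord Ω θ (s • θ + y) := by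
  ext t
  refine forall₂_congr fun τ _ => ?_
  change (s + τ • (1 : ℝ)) • θ + y ∈ Ω ↔ _
  have : (s + τ • (1 : ℝ)) • θ + y = s • θ + y + τ • θ := by
    rw [smul_eq_mul, mul_one]; module
  rw [this]

theorem IsRegularAt.lineSection {y : Eu d} {s : ℝ} (h : IsRegularAt Ω θ u w (s • θ + y)) :
    IsRegularAt (lineSection Ω θ y) (1 : ℝ) (fun s => u (s • θ + y)) (fun s => w (s • θ + y)) s := by
  have e : ∀ t : ℝ, (s + t • (1 : ℝ)) • θ + y = s • θ + y + t • θ := fun t => by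
    rw [smul_eq_mul, mul_one]; module
  constructor
  · simp only [chord_lineSection, e]
    exact h.memLp
  · simp only [chord_lineSection, e]
    exact h.ae_eq

theorem isBounded_lineSection (hb : Bornology.IsBounded Ω) (hθ : ‖θ‖ = 1) (y : Eu d) :
    Bornology.IsBounded (lineSection Ω θ y) := by
  obtain ⟨r, hr⟩ := hb.subset_closedBall 0
  refine (Metric.isBounded_closedBall (x := (0 : ℝ)) (r := r + ‖y‖)).subset fun s hs => ?_
  have h1 : ‖s • θ + y‖ ≤ r := by simpa using hr hs
  have h2 : ‖s • θ‖ ≤ ‖s • θ + y‖ + ‖y‖ := by simpa using norm_sub_le (s • θ + y) y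
  rw [norm_smul, hθ, mul_one] at h2
  simp only [Metric.mem_closedBall, dist_zero_right]
  linarith

/-- On almost every line, almost every point is regular and satisfies the identity. One such point
in a component determines both the continuous representative there and the value of `g` at its right
endpoint. -/
theorem isDirTrace_of_comp_Phi_ae_eq (hΩ : IsOpen Ω) (hb : Bornology.IsBounded Ω)
    (hθ : ‖θ‖ = 1) (hum : StronglyMeasurable u) (hwm : StronglyMeasurable w)
    (hu : MemLp u 2 (volume.restrict Ω)) (hw : MemLp w 2 (volume.restrict Ω))
    (hreg : ∀ᵐ x ∂(volume.restrict Ω), IsRegularAt Ω θ u w x)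
    (hg : ∀ᵐ x ∂(volume.restrict Ω), g (Phi Ω θ x) = endVal Ω θ u w x) :
    IsDirTrace Ω θ u g := by
  obtain ⟨r, hr⟩ := hb.subset_closedBall 0
  have hgood := hreg.and hg
  rw [ae_restrict_iff' hΩ.measurableSet] at hgood
  have hae := ((ae_memLp_slice hΩ.measurableSet hθ hum hu).and
    (ae_memLp_slice hΩ.measurableSet hθ hwm hw)).and (ae_ae_slice hθ hgood)
  obtain ⟨A, hA, hAp⟩ := eventually_iff_exists_mem.1 hae
  refine ⟨u, ae_eq_refl _, projSet Ω θ ∩ A, inter_subset_left, ?_, fun y hy => ?_⟩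
  · exact measure_mono_null (fun y hy hcon => hy.2 ⟨hy.1, hcon⟩) hA
  obtain ⟨⟨huy, hwy⟩, hline⟩ := hAp y hy.2
  have hopen : IsOpen (OmniTrace.lineSection Ω θ y) :=
    hΩ.preimage (by fun_prop : Continuous fun s : ℝ => s • θ + (y : Eu d))
  refine ⟨⟨huy, fun s => w (s • θ + y), hwy, ?_⟩, fun α β hαβ => ?_⟩
  · refine hasWeakDirDeriv_of_ae_isRegularAt hopen (isBounded_lineSection hb hθ _) (by simp)
      (hum.comp_measurable (by fun_prop)) (hwm.comp_measurable (by fun_prop)) huy hwy ?_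
    rw [ae_restrict_iff' hopen.measurableSet]
    filter_upwards [hline] with s hs hmem using (hs hmem).1.lineSection
  · obtain ⟨hlt, hsub, hα, hβ⟩ := hαβ
    -- A component has positive length, so the full-measure set of good parameters meets it.
    obtain ⟨s, hs, hsI⟩ : ∃ s, (s • θ + (y : Eu d) ∈ Ω → IsRegularAt Ω θ u w (s • θ + y) ∧
        g (Phi Ω θ (s • θ + y)) = endVal Ω θ u w (s • θ + y)) ∧ s ∈ Ioo α β := by
      have : (volume.restrict (Ioo α β)) ≠ 0 := by
        rw [ne_eq, Measure.restrict_eq_zero, Real.volume_Ioo, ENNReal.ofReal_eq_zero]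
        linarith
      have : NeBot (ae (volume.restrict (Ioo α β))) := ae_neBot.2 this
      exact ((ae_restrict_of_ae hline).and (ae_restrict_mem measurableSet_Ioo)).exists
    have hxΩ : s • θ + (y : Eu d) ∈ Ω := hsub hsI
    obtain ⟨hx, hgx⟩ := hs hxΩ
    set x := s • θ + (y : Eu d) with hxdef
    have e1 : exitTime Ω θ x = β - s := by
      refine exitTime_eq (by linarith [hsI.2]) (fun t ht => ?_) fun hcon => hβ ?_
      · have : x + t • θ = (s + t) • θ + y := by rw [hxdef]; module
        rw [this]
        exact hsub ⟨by linarith [hsI.1, ht.1], by linarith [ht.2]⟩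
      · change β • θ + (y : Eu d) ∈ Ω
        convert hcon using 1
        rw [hxdef]; module
    have e2 : exitTime Ω (-θ) x = s - α := by
      refine exitTime_eq (by linarith [hsI.1]) (fun t ht => ?_) fun hcon => hα ?_
      · have : x + t • -θ = (s - t) • θ + y := by rw [hxdef]; module
        rw [this]
        exact hsub ⟨by linarith [ht.2], by linarith [hsI.2, ht.1]⟩
      · change α • θ + (y : Eu d) ∈ Ω
        convert hcon using 1
        rw [hxdef]; module
    have hcont := continuousOn_primitive_chord hΩ hb hθ hxΩ hx s
    have haeq := ae_primitive_eq hΩ hb hθ hxdef hxΩ hx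
    rw [e1, e2, sub_sub_cancel, add_sub_cancel] at hcont haeq
    refine ⟨_, hcont, ?_, ?_⟩
    · filter_upwards [ae_restrict_of_ae haeq, ae_restrict_mem measurableSet_Ioo] with τ h1 h2
      exact (h1 h2).symm
    · have : Phi Ω θ x = β • θ + y := by
        change x + exitTime Ω θ x • θ = _
        rw [e1, hxdef]; module
      rw [← this, hgx, endVal, e1]

end DirTrace

/-! ### The omnidirectional trace on `H¹(Ω)` -/

section OmniTraceH1

variable {d : ℕ} {Ω : Set (Eu d)}

theorem norm_sph (θ : Sph d) : ‖(θ : Eu d)‖ = 1 := norm_eq_of_mem_sphere θ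

theorem H1val_stronglyMeasurable (u : H1 Ω) : StronglyMeasurable (H1val u) :=
  Lp.stronglyMeasurable _

theorem H1val_memLp (u : H1 Ω) : MemLp (H1val u) 2 (volume.restrict Ω) := Lp.memLp _

theorem H1dirDeriv_stronglyMeasurable (u : H1 Ω) (θ : Eu d) :
    StronglyMeasurable (H1dirDeriv u θ) :=
  stronglyMeasurable_const.inner (Lp.stronglyMeasurable _)

theorem H1dirDeriv_memLp (u : H1 Ω) (θ : Eu d) :
    MemLp (H1dirDeriv u θ) 2 (volume.restrict Ω) := (Lp.memLp _).const_inner θ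

theorem H1dirDeriv_neg (u : H1 Ω) (θ : Eu d) : H1dirDeriv u (-θ) = -H1dirDeriv u θ := by
  ext x
  simp [H1dirDeriv]

theorem H1_ae_isRegularAt (hΩ : IsOpen Ω) (hb : Bornology.IsBounded Ω) (u : H1 Ω) (θ : Sph d) :
    ∀ᵐ x ∂(volume.restrict Ω), IsRegularAt Ω (θ : Eu d) (H1val u) (H1dirDeriv u θ) x :=
  HasWeakDirDeriv.ae_isRegularAt (u.2 θ) hΩ hb (norm_sph θ) (H1val_stronglyMeasurable u)
    (H1dirDeriv_stronglyMeasurable u θ) (H1val_memLp u) (H1dirDeriv_memLp u θ)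

/-- Turns traces into an equation between functions on `Ω` with fixed representatives; the
estimates, the limit argument and the integral formula all go through it. -/
theorem isOmniTrace_iff (hΩ : IsOpen Ω) (hb : Bornology.IsBounded Ω) (u : H1 Ω) (g : Eu d → ℝ) :
    IsOmniTrace Ω u g ↔ g ∈ calL2 (dirMeasures Ω) ∧ ∀ θ : Sph d, ∀ᵐ x ∂(volume.restrict Ω),
      g (Phi Ω θ x) = endVal Ω (θ : Eu d) (H1val u) (H1dirDeriv u θ) x := by
  refine and_congr_right fun _ => forall_congr' fun θ => ⟨?_, fun h => ?_⟩
  · rintro ⟨h, hh, hg⟩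
    filter_upwards [hh.comp_Phi_ae_eq hΩ hb (norm_sph θ) (H1_ae_isRegularAt hΩ hb u θ),
      ae_of_ae_map (measurable_Phi hΩ hb (norm_sph θ)).aemeasurable hg] with x h1 h2
    rw [← h2, h1]
  · exact ⟨g, isDirTrace_of_comp_Phi_ae_eq hΩ hb (norm_sph θ) (H1val_stronglyMeasurable u)
      (H1dirDeriv_stronglyMeasurable u θ) (H1val_memLp u) (H1dirDeriv_memLp u θ)
      (H1_ae_isRegularAt hΩ hb u θ) h, ae_eq_refl _⟩

/-! ### Estimates uniform in the direction -/

theorem eLpNorm_H1val_sub_le (u v : H1 Ω) :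
    eLpNorm (H1val u - H1val v) 2 (volume.restrict Ω) ≤ ENNReal.ofReal ‖u - v‖ := by
  have h : H1val u - H1val v =ᵐ[volume.restrict Ω] ((u - v : H1 Ω) : L2Pair Ω).fst :=
    (Lp.coeFn_sub _ _).symm
  rw [eLpNorm_congr_ae h, ← Lp.enorm_def, ← ofReal_norm]
  exact ENNReal.ofReal_le_ofReal (WithLp.norm_fst_le _ _)

theorem eLpNorm_H1dirDeriv_sub_le (u v : H1 Ω) (θ : Sph d) :
    eLpNorm (H1dirDeriv u θ - H1dirDeriv v θ) 2 (volume.restrict Ω) ≤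
      ENNReal.ofReal ‖u - v‖ := by
  have h : ∀ᵐ x ∂(volume.restrict Ω), ‖(H1dirDeriv u θ - H1dirDeriv v θ) x‖ ≤
      ‖((u - v : H1 Ω) : L2Pair Ω).snd x‖ := by
    filter_upwards [Lp.coeFn_sub (u : L2Pair Ω).snd (v : L2Pair Ω).snd] with x hx
    have e : ((u - v : H1 Ω) : L2Pair Ω).snd x = (u : L2Pair Ω).snd x - (v : L2Pair Ω).snd x := hx
    rw [e, Pi.sub_apply, H1dirDeriv, H1dirDeriv, ← inner_sub_right]
    simpa [norm_sph θ] using norm_inner_le_norm (𝕜 := ℝ) (θ : Eu d)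
      ((u : L2Pair Ω).snd x - (v : L2Pair Ω).snd x)
  refine (eLpNorm_mono_ae h).trans ?_
  rw [← Lp.enorm_def, ← ofReal_norm]
  exact ENNReal.ofReal_le_ofReal (WithLp.norm_snd_le _ _)

theorem eLpNorm_endVal_sub_le (hΩ : IsOpen Ω) {r : ℝ} (hr : Ω ⊆ Metric.closedBall 0 r)
    (hr0 : 0 ≤ r) (u v : H1 Ω) (θ : Sph d) :
    eLpNorm (endVal Ω (θ : Eu d) (H1val u) (H1dirDeriv u θ) -
      endVal Ω (θ : Eu d) (H1val v) (H1dirDeriv v θ)) 2 (volume.restrict Ω) ≤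
      ENNReal.ofReal ((1 + 4 * r) * ‖u - v‖) := by
  have hb : Bornology.IsBounded Ω := Metric.isBounded_closedBall.subset hr
  rw [eLpNorm_congr_ae (endVal_sub_ae hΩ hb (norm_sph θ) (H1dirDeriv_stronglyMeasurable u θ)
    (H1dirDeriv_stronglyMeasurable v θ) (H1dirDeriv_memLp u θ) (H1dirDeriv_memLp v θ))]
  refine (eLpNorm_endVal_le hΩ hr (norm_sph θ)
    ((H1val_stronglyMeasurable u).sub (H1val_stronglyMeasurable v))
    ((H1dirDeriv_stronglyMeasurable u θ).sub (H1dirDeriv_stronglyMeasurable v θ))).trans ?_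
  rw [add_mul, one_mul, ENNReal.ofReal_add (norm_nonneg _) (by positivity),
    ENNReal.ofReal_mul (p := 4 * r) (by positivity)]
  gcongr
  · exact eLpNorm_H1val_sub_le u v
  · exact eLpNorm_H1dirDeriv_sub_le u v θ

theorem IsOmniTrace.aestronglyMeasurable {u : H1 Ω} {g : Eu d → ℝ} (h : IsOmniTrace Ω u g)
    (θ : Sph d) : AEStronglyMeasurable g (dirMeasure Ω θ) :=
  (h.1.choose_spec θ).1.1

/-- Pulled back by `Φ_θ`, the norm becomes that of a difference of end values on `Ω`. With `u = v`
this is uniqueness of the trace; in general it is its Lipschitz continuity. -/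
theorem IsOmniTrace.eLpNorm_sub_le (hΩ : IsOpen Ω) {r : ℝ} (hr : Ω ⊆ Metric.closedBall 0 r)
    (hr0 : 0 ≤ r) {u v : H1 Ω} {g h : Eu d → ℝ} (hg : IsOmniTrace Ω u g)
    (hh : IsOmniTrace Ω v h) (θ : Sph d) :
    eLpNorm (g - h) 2 (dirMeasure Ω θ) ≤ ENNReal.ofReal ((1 + 4 * r) * ‖u - v‖) := by
  have hb : Bornology.IsBounded Ω := Metric.isBounded_closedBall.subset hr
  refine le_trans (le_of_eq ?_) (eLpNorm_endVal_sub_le hΩ hr hr0 u v θ)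
  rw [dirMeasure, eLpNorm_map_measure
    ((hg.aestronglyMeasurable θ).sub (hh.aestronglyMeasurable θ))
    (measurable_Phi hΩ hb (norm_sph θ)).aemeasurable]
  refine eLpNorm_congr_ae ?_
  filter_upwards [((isOmniTrace_iff hΩ hb u g).1 hg).2 θ,
    ((isOmniTrace_iff hΩ hb v h).1 hh).2 θ] with x h1 h2
  simp [h1, h2]

theorem IsOmniTrace.ae_eq (hΩ : IsOpen Ω) (hb : Bornology.IsBounded Ω)
    {u : H1 Ω} {g h : Eu d → ℝ} (hg : IsOmniTrace Ω u g)
    (hh : IsOmniTrace Ω u h) (θ : Sph d) : g =ᵐ[dirMeasure Ω θ] h := by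
  obtain ⟨r, hr0, hr⟩ := hb.subset_closedBall_lt 0 0
  have := hg.eLpNorm_sub_le hΩ hr hr0.le hh θ
  rw [sub_self, norm_zero, mul_zero, ENNReal.ofReal_zero, nonpos_iff_eq_zero,
    eLpNorm_eq_zero_iff ((hg.aestronglyMeasurable θ).sub (hh.aestronglyMeasurable θ))
      (by norm_num)] at this
  exact (sub_ae_eq_zero g h).1 this

theorem isOmniTrace_iff_mk_eq_tr (hΩ : IsOpen Ω) (hb : Bornology.IsBounded Ω) (u : H1tr Ω)
    (g : Eu d → ℝ) (hg : g ∈ calL2 (dirMeasures Ω)) :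
    IsOmniTrace Ω (u : H1 Ω) g ↔ L2Family.mk g hg = tr Ω u := by
  have hc := u.2.choose_spec
  rw [tr, L2Family.mk_eq_mk_iff]
  constructor
  · exact fun h θ => h.ae_eq hΩ hb hc θ
  · intro h
    refine ⟨hg, fun θ => ?_⟩
    obtain ⟨k, hk, hk'⟩ := hc.2 θ
    exact ⟨k, hk, hk'.trans (h θ).symm⟩

/-! ### Completeness of `H¹(Ω)` and closedness of `H¹_tr(Ω)` -/

theorem isClosed_H1 (Ω : Set (Eu d)) : IsClosed (H1 Ω : Set (L2Pair Ω)) := by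
  have e : (H1 Ω : Set (L2Pair Ω)) = ⋂ (θ : Eu d) (φ : Eu d → ℝ) (_ : IsTestFunction Ω φ),
      {p : L2Pair Ω | ∫ x in Ω, p.fst x * fderiv ℝ φ x θ =
        - ∫ x in Ω, inner ℝ θ (p.snd x) * φ x} := by
    ext p
    simp only [mem_iInter]
    rfl
  rw [e]
  refine isClosed_iInter fun θ => isClosed_iInter fun φ => isClosed_iInter fun hφ => ?_
  have hφθ : MemLp (fun x => φ x • θ) 2 (volume.restrict Ω) := by
    refine (Continuous.memLp_of_hasCompactSupport (hφ.1.continuous.smul continuous_const) ?_).restrict Ω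
    exact hφ.2.1.smul_right
  -- Both sides of the weak identity are inner products with a fixed `L²` element, hence continuous
  -- in `p`.
  have e₁ : ∀ p : L2Pair Ω, ∫ x in Ω, p.fst x * fderiv ℝ φ x θ =
      inner ℝ ((hφ.memLp_fderiv θ).toLp _) p.fst := by
    intro p
    rw [L2.inner_def]
    refine integral_congr_ae ?_
    filter_upwards [(hφ.memLp_fderiv θ).coeFn_toLp] with x hx
    rw [hx]
    simp
  have e₂ : ∀ p : L2Pair Ω, ∫ x in Ω, inner ℝ θ (p.snd x) * φ x =
      inner ℝ (hφθ.toLp _) p.snd := by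
    intro p
    rw [L2.inner_def]
    refine integral_congr_ae ?_
    filter_upwards [hφθ.coeFn_toLp] with x hx
    rw [hx, inner_smul_left]
    simp [mul_comm]
  simp_rw [e₁, e₂]
  have c₁ : Continuous fun p : L2Pair Ω => p.fst := WithLp.prod_continuous_ofLp 2 _ _ |>.fst
  have c₂ : Continuous fun p : L2Pair Ω => p.snd := WithLp.prod_continuous_ofLp 2 _ _ |>.snd
  exact isClosed_eq (continuous_const.inner c₁) (continuous_const.inner c₂).neg

instance : CompleteSpace (H1 Ω) := (isClosed_H1 Ω).completeSpace_coe

theorem comp_Phi_ae_eq_of_tendsto (hΩ : IsOpen Ω) (hb : Bornology.IsBounded Ω) {u : H1 Ω}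
    {v : ℕ → H1 Ω} {g : ℕ → Eu d → ℝ} {G : Eu d → ℝ} (hv : Tendsto v atTop (𝓝 u))
    (hg : ∀ n, IsOmniTrace Ω (v n) (g n)) (θ : Sph d)
    (hGm : AEStronglyMeasurable G (dirMeasure Ω θ))
    (hG : Tendsto (fun n => eLpNorm (g n - G) 2 (dirMeasure Ω θ)) atTop (𝓝 0)) :
    G ∘ Phi Ω θ =ᵐ[volume.restrict Ω] endVal Ω (θ : Eu d) (H1val u) (H1dirDeriv u θ) := by
  obtain ⟨r, hr0, hr⟩ := hb.subset_closedBall_lt 0 0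
  have hΦ := (measurable_Phi hΩ hb (norm_sph θ)).aemeasurable (μ := volume.restrict Ω)
  have hEm : ∀ u : H1 Ω, AEStronglyMeasurable
      (endVal Ω (θ : Eu d) (H1val u) (H1dirDeriv u θ)) (volume.restrict Ω) := fun u =>
    (stronglyMeasurable_endVal hΩ hb (norm_sph θ) (H1val_stronglyMeasurable u)
      (H1dirDeriv_stronglyMeasurable u θ)).aestronglyMeasurable
  have hle : ∀ n, eLpNorm (endVal Ω (θ : Eu d) (H1val u) (H1dirDeriv u θ) - G ∘ Phi Ω θ) 2
      (volume.restrict Ω) ≤ ENNReal.ofReal ((1 + 4 * r) * ‖u - v n‖) +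
        eLpNorm (g n - G) 2 (dirMeasure Ω θ) := by
    intro n
    have hsub := ((hg n).aestronglyMeasurable θ).sub hGm
    have e : endVal Ω (θ : Eu d) (H1val u) (H1dirDeriv u θ) - G ∘ Phi Ω θ =ᵐ[volume.restrict Ω]
        (endVal Ω (θ : Eu d) (H1val u) (H1dirDeriv u θ) -
          endVal Ω (θ : Eu d) (H1val (v n)) (H1dirDeriv (v n) θ)) + (g n - G) ∘ Phi Ω θ := by
      filter_upwards [((isOmniTrace_iff hΩ hb _ _).1 (hg n)).2 θ] with x hx
      simp only [Pi.sub_apply, Pi.add_apply, Function.comp_apply, hx]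
      ring
    rw [eLpNorm_congr_ae e, dirMeasure, eLpNorm_map_measure hsub hΦ]
    refine (eLpNorm_add_le ((hEm _).sub (hEm _)) (hsub.comp_aemeasurable hΦ)
      (by norm_num)).trans ?_
    gcongr
    exact eLpNorm_endVal_sub_le hΩ hr hr0.le u (v n) θ
  have hz : Tendsto (fun n : ℕ => ENNReal.ofReal ((1 + 4 * r) * ‖u - v n‖) +
      eLpNorm (g n - G) 2 (dirMeasure Ω θ)) atTop (𝓝 0) := by
    have h1 : Tendsto (fun n : ℕ => (1 + 4 * r) * ‖u - v n‖) atTop (𝓝 ((1 + 4 * r) * ‖u - u‖)) :=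
      (tendsto_const_nhds.sub hv).norm.const_mul _
    have h2 := ENNReal.tendsto_ofReal h1
    rw [sub_self, norm_zero, mul_zero, ENNReal.ofReal_zero] at h2
    simpa using h2.add hG
  have h0 := le_antisymm (ge_of_tendsto' hz hle) zero_le
  rw [eLpNorm_eq_zero_iff ((hEm _).sub (hGm.comp_aemeasurable hΦ)) (by norm_num)] at h0
  exact ((sub_ae_eq_zero _ _).1 h0).symm

/-- Square integrability and the bound uniform in `θ` need not be assumed: they follow from the
trace inequality, applied to the difference of `u` and `0`. -/
theorem isOmniTrace_of_comp_Phi_ae_eq (hΩ : IsOpen Ω) (hb : Bornology.IsBounded Ω) {u : H1 Ω}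
    {g : Eu d → ℝ} (hgm : ∀ θ : Sph d, AEStronglyMeasurable g (dirMeasure Ω θ))
    (hg : ∀ θ : Sph d, g ∘ Phi Ω θ =ᵐ[volume.restrict Ω]
      endVal Ω (θ : Eu d) (H1val u) (H1dirDeriv u θ)) : IsOmniTrace Ω u g := by
  obtain ⟨r, hr0, hr⟩ := hb.subset_closedBall_lt 0 0
  have hnorm : ∀ θ : Sph d, eLpNorm g 2 (dirMeasure Ω θ) ≤
      ENNReal.ofReal ((1 + 4 * r) * ‖u‖) := by
    intro θ
    rw [dirMeasure, eLpNorm_map_measure (hgm θ) (measurable_Phi hΩ hb (norm_sph θ)).aemeasurable]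
    have e : g ∘ Phi Ω θ =ᵐ[volume.restrict Ω]
        endVal Ω (θ : Eu d) (H1val u) (H1dirDeriv u θ) -
          endVal Ω (θ : Eu d) (H1val (0 : H1 Ω)) (H1dirDeriv (0 : H1 Ω) θ) := by
      filter_upwards [hg θ, ((isOmniTrace_iff hΩ hb _ _).1 (isOmniTrace_zero Ω)).2 θ] with x h1 h2
      rw [h1, Pi.sub_apply, ← h2, Pi.zero_apply, sub_zero]
    rw [eLpNorm_congr_ae e]
    have := eLpNorm_endVal_sub_le hΩ hr hr0.le u 0 θ
    rwa [sub_zero] at this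
  refine (isOmniTrace_iff hΩ hb u g).2
    ⟨⟨(1 + 4 * r) * ‖u‖, fun θ => ⟨⟨hgm θ, ?_⟩, ?_⟩⟩, hg⟩
  · exact (hnorm θ).trans_lt ENNReal.ofReal_lt_top
  · exact ENNReal.toReal_le_of_le_ofReal (by positivity) (hnorm θ)

/-- Completeness of each `L²(μ_θ)` alone would give a limit depending on `θ`. The summable rate, the
same for all `θ`, gives pointwise convergence of the one sequence `g n` almost everywhere for each
`μ_θ`. -/
theorem exists_isOmniTrace_of_geometric (hΩ : IsOpen Ω) (hb : Bornology.IsBounded Ω) {u : H1 Ω}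
    {v : ℕ → H1 Ω} {g : ℕ → Eu d → ℝ} (hg : ∀ n, IsOmniTrace Ω (v n) (g n))
    (hv : ∀ n, ‖v n - u‖ < (1 / 2 : ℝ) ^ n) : ∃ G, IsOmniTrace Ω u G := by
  obtain ⟨r, hr0, hr⟩ := hb.subset_closedBall_lt 0 0
  -- Two geometric errors already account for a factor `2`; the constant `3` leaves room.
  have hB : ∑' n : ℕ, ENNReal.ofReal (3 * (1 + 4 * r) * (1 / 2 : ℝ) ^ n) ≠ ⊤ :=
    (summable_geometric_two.mul_left (3 * (1 + 4 * r))).tsum_ofReal_ne_top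
  have hcau : ∀ θ : Sph d, ∀ N n m : ℕ, N ≤ n → N ≤ m →
      eLpNorm (g n - g m) 2 (dirMeasure Ω θ) <
        ENNReal.ofReal (3 * (1 + 4 * r) * (1 / 2 : ℝ) ^ N) := by
    intro θ N n m hn hm
    refine ((hg n).eLpNorm_sub_le hΩ hr hr0.le (hg m) θ).trans_lt ?_
    have hpow : ∀ k, N ≤ k → ‖v k - u‖ < (1 / 2 : ℝ) ^ N := fun k hk => (hv k).trans_le
      (pow_le_pow_of_le_one (by norm_num) (by norm_num) hk)
    have h1 : ‖v n - v m‖ ≤ ‖v n - u‖ + ‖v m - u‖ := by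
      rw [norm_sub_rev (v m) u]
      exact norm_sub_le_norm_sub_add_norm_sub _ _ _
    have h4 : (0 : ℝ) < (1 / 2) ^ N := by positivity
    refine (ENNReal.ofReal_lt_ofReal_iff (by positivity)).2 ?_
    rw [mul_comm 3, mul_assoc]
    refine mul_lt_mul_of_pos_left ?_ (by positivity)
    linarith [hpow n hn, hpow m hm]
  have hvu : Tendsto v atTop (𝓝 u) := by
    rw [tendsto_iff_norm_sub_tendsto_zero]
    exact squeeze_zero (fun n => norm_nonneg _) (fun n => (hv n).le)
      (tendsto_pow_atTop_nhds_zero_of_lt_one (by norm_num) (by norm_num))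
  -- The definition involves no direction. Where the sequence diverges `limUnder` takes an arbitrary
  -- value, on a set that is null for every `μ_θ`.
  obtain ⟨G, hGdef⟩ : ∃ G : Eu d → ℝ, ∀ z, G z = limUnder atTop fun n => g n z := ⟨_, fun _ => rfl⟩
  have hlim : ∀ θ : Sph d, ∀ᵐ z ∂(dirMeasure Ω θ), Tendsto (fun n => g n z) atTop (𝓝 (G z)) := by
    intro θ
    filter_upwards [Lp.ae_tendsto_of_cauchy_eLpNorm
      (fun n => (hg n).aestronglyMeasurable θ) (by norm_num) hB (hcau θ)] with z hz
    rw [hGdef]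
    exact tendsto_nhds_limUnder hz
  have hGm : ∀ θ : Sph d, AEStronglyMeasurable G (dirMeasure Ω θ) := fun θ =>
    aestronglyMeasurable_of_tendsto_ae atTop (fun n => (hg n).aestronglyMeasurable θ) (hlim θ)
  exact ⟨G, isOmniTrace_of_comp_Phi_ae_eq hΩ hb hGm fun θ =>
    comp_Phi_ae_eq_of_tendsto hΩ hb hvu hg θ (hGm θ)
      (Lp.cauchy_tendsto_of_tendsto (fun n => (hg n).aestronglyMeasurable θ) G hB (hcau θ)
        (hlim θ))⟩

theorem isClosed_H1tr (hΩ : IsOpen Ω) (hb : Bornology.IsBounded Ω) :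
    IsClosed (H1tr Ω : Set (H1 Ω)) := by
  refine isClosed_of_closure_subset fun u hu => ?_
  have hex : ∀ n : ℕ, ∃ v : H1 Ω, ∃ g, IsOmniTrace Ω v g ∧ ‖v - u‖ < (1 / 2 : ℝ) ^ n := by
    intro n
    obtain ⟨v, ⟨g, hg⟩, hd⟩ := Metric.mem_closure_iff.1 hu ((1 / 2 : ℝ) ^ n) (by positivity)
    exact ⟨v, g, hg, by rwa [dist_comm, dist_eq_norm] at hd⟩
  choose v g hg hv using hex
  exact exists_isOmniTrace_of_geometric hΩ hb hg hv

theorem isLinearMap_tr (hΩ : IsOpen Ω) (hb : Bornology.IsBounded Ω) : IsLinearMap ℝ (tr Ω) := by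
  constructor
  · intro u v
    have hu := u.2.choose_spec
    have hv := v.2.choose_spec
    have h : IsOmniTrace Ω ((u + v : H1tr Ω) : H1 Ω) (u.2.choose + v.2.choose) := by
      have := hu.lincomb (a := 1) (b := 1) (u := ((u + v : H1tr Ω) : H1 Ω)) hv ?_
      · simp only [one_mul] at this
        exact this
      · filter_upwards [Lp.coeFn_add ((u : H1 Ω) : L2Pair Ω).fst ((v : H1 Ω) : L2Pair Ω).fst]
          with x hx
        rw [one_mul, one_mul]
        exact hx
    exact ((isOmniTrace_iff_mk_eq_tr hΩ hb (u + v) _ h.1).1 h).symm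
  · intro c u
    have hu := u.2.choose_spec
    have h : IsOmniTrace Ω ((c • u : H1tr Ω) : H1 Ω) (c • u.2.choose) := by
      have := hu.lincomb (a := c) (b := 0) (u := ((c • u : H1tr Ω) : H1 Ω)) hu ?_
      · simp only [zero_mul, add_zero] at this
        exact this
      · filter_upwards [Lp.coeFn_smul c ((u : H1 Ω) : L2Pair Ω).fst] with x hx
        rw [zero_mul, add_zero]
        exact hx
    exact ((isOmniTrace_iff_mk_eq_tr hΩ hb (c • u) _ h.1).1 h).symm

theorem continuous_tr (hΩ : IsOpen Ω) (hb : Bornology.IsBounded Ω) : Continuous (tr Ω) := by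
  obtain ⟨r, hr0, hr⟩ := hb.subset_closedBall_lt 0 0
  have hC : 0 ≤ 1 + 4 * r := by positivity
  refine (LipschitzWith.of_dist_le_mul (K := ⟨1 + 4 * r, hC⟩) fun u v => ?_).continuous
  rw [tr, tr, L2Family.mk, L2Family.mk, SeparationQuotient.dist_mk, dist_eq_norm, CalL2.norm_def]
  refine Real.iSup_le (fun θ => ?_) (by positivity)
  refine ENNReal.toReal_le_of_le_ofReal (by positivity) ?_
  have := u.2.choose_spec.eLpNorm_sub_le hΩ hr hr0.le v.2.choose_spec θ
  rw [dist_eq_norm]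
  exact this

end OmniTraceH1

/-! ### Integration by parts -/

section Parts

variable {d : ℕ} {Ω : Set (Eu d)} {θ x : Eu d}

/-- The exit point is outside `Ω`, but `t = 0` does not count in `chordDist`; looking back from it,
the whole chord is seen. -/
theorem chordDist_neg_Phi (hΩ : IsOpen Ω) (hb : Bornology.IsBounded Ω) (hθ : ‖θ‖ = 1)
    (hx : x ∈ Ω) : chordDist Ω (-θ) (Phi Ω θ x) = exitTime Ω θ x + exitTime Ω (-θ) x := by
  obtain ⟨r, hr⟩ := hb.subset_closedBall 0
  obtain ⟨e1, -⟩ := exitTime_spec hΩ hr hθ hx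
  obtain ⟨e2, -, -, e3⟩ := exitTime_spec hΩ hr (θ := -θ) (by simpa using hθ) hx
  refine exitTime_eq (by linarith) (fun t ht => ?_) fun hcon => e3 ?_
  · have : Phi Ω θ x + t • -θ = x + (exitTime Ω θ x - t) • θ := by
      change x + exitTime Ω θ x • θ + t • -θ = _
      module
    rw [this]
    refine add_smul_mem_of_mem_chord ?_
    rw [chord_eq_Ioo hΩ hr hθ hx]
    constructor <;> linarith [ht.1, ht.2]
  · convert hcon using 1
    change _ = x + exitTime Ω θ x • θ + _
    module

theorem Phi_neg_Phi (hΩ : IsOpen Ω) (hb : Bornology.IsBounded Ω) (hθ : ‖θ‖ = 1)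
    (hx : x ∈ Ω) : Phi Ω (-θ) (Phi Ω θ x) = Phi Ω (-θ) x := by
  rw [Phi, chordDist_neg_Phi hΩ hb hθ hx]
  change x + exitTime Ω θ x • θ + _ = x + exitTime Ω (-θ) x • -θ
  module

theorem chordLen_Phi (hΩ : IsOpen Ω) (hb : Bornology.IsBounded Ω) (hθ : ‖θ‖ = 1)
    (hx : x ∈ Ω) : chordLen Ω θ (Phi Ω θ x) = (volume (chord Ω θ x)).toReal := by
  obtain ⟨r, hr⟩ := hb.subset_closedBall 0
  have e1 := (exitTime_spec hΩ hr hθ hx).1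
  have e2 := (exitTime_spec hΩ hr (θ := -θ) (by simpa using hθ) hx).1
  rw [chordLen, Phi, chordDist_neg_Phi hΩ hb hθ hx, add_sub_cancel_left, norm_smul, norm_neg, hθ,
    mul_one, Real.norm_of_nonneg (by linarith), volume_chord hΩ hr hθ hx,
    ENNReal.toReal_ofReal (by linarith)]

/-- Going to the exit point and back across the chord leads to the same place as going backwards at
once. -/
theorem map_Phi_neg_dirMeasure (hΩ : IsOpen Ω) (hb : Bornology.IsBounded Ω) (hθ : ‖θ‖ = 1) :
    Measure.map (Phi Ω (-θ)) (dirMeasure Ω θ) = dirMeasure Ω (-θ) := by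
  rw [dirMeasure, dirMeasure, Measure.map_map (measurable_Phi hΩ hb (by simpa using hθ))
    (measurable_Phi hΩ hb hθ)]
  refine Measure.map_congr ?_
  filter_upwards [ae_restrict_mem hΩ.measurableSet] with x hx
  exact Phi_neg_Phi hΩ hb hθ hx

theorem IsOmniTrace.integral_by_parts (hΩ : IsOpen Ω) (hb : Bornology.IsBounded Ω) {u v : H1 Ω}
    {g h : Eu d → ℝ} (hg : IsOmniTrace Ω u g) (hh : IsOmniTrace Ω v h) (θ : Sph d) :
    Integrable (fun z => (g z * h z - g (Phi Ω (-θ) z) * h (Phi Ω (-θ) z)) /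
      chordLen Ω θ z) (dirMeasure Ω θ) ∧
    ∫ x in Ω, (H1val u x * H1dirDeriv v θ x + H1val v x * H1dirDeriv u θ x) =
      ∫ z, (g z * h z - g (Phi Ω (-θ) z) * h (Phi Ω (-θ) z)) / chordLen Ω θ z
        ∂(dirMeasure Ω θ) := by
  have hθ := norm_sph θ
  have hθ' : ‖-(θ : Eu d)‖ = 1 := by rw [norm_neg, hθ]
  have hΦ := measurable_Phi hΩ hb hθ
  have hΦ' := measurable_Phi hΩ hb hθ'
  -- A trace is only a.e. strongly measurable for each directional measure, so its composition with
  -- `Φ_{-θ}` is measurable for `μ_θ` because `Φ_{-θ}` carries `μ_θ` to `μ_{-θ}`.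
  have hneg : ∀ {k : Eu d → ℝ} {w : H1 Ω}, IsOmniTrace Ω w k →
      AEStronglyMeasurable (fun z => k (Phi Ω (-θ) z)) (dirMeasure Ω θ) := by
    intro k w hk
    refine AEStronglyMeasurable.comp_aemeasurable ?_ hΦ'.aemeasurable
    rw [map_Phi_neg_dirMeasure hΩ hb hθ]
    simpa using hk.aestronglyMeasurable (-θ)
  have hmeas : AEStronglyMeasurable (fun z => (g z * h z - g (Phi Ω (-θ) z) * h (Phi Ω (-θ) z)) /
      chordLen Ω θ z) (dirMeasure Ω θ) := by
    have hl : Measurable (chordLen Ω (θ : Eu d)) := (hΦ'.sub measurable_id).norm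
    simp_rw [div_eq_mul_inv]
    exact (((hg.aestronglyMeasurable θ).mul (hh.aestronglyMeasurable θ)).sub
      ((hneg hg).mul (hneg hh))).mul hl.inv.aestronglyMeasurable
  set f : Eu d → ℝ := fun x => H1val u x * H1dirDeriv v θ x + H1val v x * H1dirDeriv u θ x
  have hf : StronglyMeasurable f :=
    ((H1val_stronglyMeasurable u).mul (H1dirDeriv_stronglyMeasurable v θ)).add
      ((H1val_stronglyMeasurable v).mul (H1dirDeriv_stronglyMeasurable u θ))
  have hfi : IntegrableOn f Ω := ((H1val_memLp u).integrable_mul (H1dirDeriv_memLp v θ)).add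
    ((H1val_memLp v).integrable_mul (H1dirDeriv_memLp u θ))
  obtain ⟨hI, hE⟩ := integral_chord hΩ hb hθ hf hfi
  have key : (fun x => (volume (chord Ω (θ : Eu d) x)).toReal⁻¹ *
      ∫ t in chord Ω (θ : Eu d) x, f (x + t • (θ : Eu d))) =ᵐ[volume.restrict Ω]
      (fun z => (g z * h z - g (Phi Ω (-θ) z) * h (Phi Ω (-θ) z)) / chordLen Ω θ z) ∘ Phi Ω θ := by
    have hgi := ((isOmniTrace_iff hΩ hb u g).1 hg).2
    have hhi := ((isOmniTrace_iff hΩ hb v h).1 hh).2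
    -- The same `g` and `h` also represent the traces in the direction `-θ`; this gives the values
    -- at the other end of the chord.
    have hgn := hgi (-θ)
    have hhn := hhi (-θ)
    rw [coe_neg_sphere, H1dirDeriv_neg] at hgn hhn
    filter_upwards [ae_restrict_mem hΩ.measurableSet, H1_ae_isRegularAt hΩ hb u θ,
      H1_ae_isRegularAt hΩ hb v θ, hgi θ, hhi θ, hgn, hhn] with x hx r1 r2 h1 h2 h3 h4
    rw [Function.comp_apply, Phi_neg_Phi hΩ hb hθ hx, chordLen_Phi hΩ hb hθ hx, h1, h2, h3, h4,
      ← integral_chord_mul_add hΩ hb hθ hx r1 r2, div_eq_inv_mul]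
  constructor
  · rw [dirMeasure, integrable_map_measure hmeas hΦ.aemeasurable]
    exact hI.congr key
  · rw [dirMeasure, integral_map hΦ.aemeasurable hmeas, ← hE]
    exact integral_congr_ae key

end Parts

end OmniTrace

end

/-! ### The theorem -/

theorem theorem3 (d : ℕ) (hd : 1 ≤ d) (Ω : Set (EuclideanSpace ℝ (Fin d)))
    (hΩ : IsOpen Ω) (hb : Bornology.IsBounded Ω) :
    -- `H¹_tr(Ω)` is closed in `H¹(Ω)`, hence a Hilbert space
    IsClosed (H1tr Ω : Set (H1 Ω)) ∧ CompleteSpace (H1tr Ω) ∧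
    -- the trace is well defined: its representatives are exactly the omnidirectional traces
    (∀ (u : H1tr Ω) (g : EuclideanSpace ℝ (Fin d) → ℝ) (hg : g ∈ calL2 (dirMeasures Ω)),
      IsOmniTrace Ω (u : H1 Ω) g ↔ L2Family.mk g hg = tr Ω u) ∧
    -- it is a continuous linear operator
    IsLinearMap ℝ (tr Ω) ∧ Continuous (tr Ω) ∧
    -- integration by parts, for all representatives `g`, `h` of `tr u`, `tr v`
    (∀ (u v : H1tr Ω) (θ : Metric.sphere (0 : EuclideanSpace ℝ (Fin d)) 1)
      (g h : EuclideanSpace ℝ (Fin d) → ℝ)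
      (hg : g ∈ calL2 (dirMeasures Ω)) (hh : h ∈ calL2 (dirMeasures Ω)),
      L2Family.mk g hg = tr Ω u → L2Family.mk h hh = tr Ω v →
      MeasureTheory.Integrable (fun z => (g z * h z - g (Phi Ω (-θ) z) * h (Phi Ω (-θ) z)) /
          chordLen Ω θ z) (dirMeasure Ω θ) ∧
      ∫ x in Ω, (H1val (u : H1 Ω) x * H1dirDeriv (v : H1 Ω) θ x +
          H1val (v : H1 Ω) x * H1dirDeriv (u : H1 Ω) θ x) =
        ∫ z, (g z * h z - g (Phi Ω (-θ) z) * h (Phi Ω (-θ) z)) / chordLen Ω θ z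
          ∂(dirMeasure Ω θ)) :=
  ⟨isClosed_H1tr hΩ hb, (isClosed_H1tr hΩ hb).completeSpace_coe,
    isOmniTrace_iff_mk_eq_tr hΩ hb, isLinearMap_tr hΩ hb, continuous_tr hΩ hb,
    fun u v θ g h hg hh hgu hhv =>
      ((isOmniTrace_iff_mk_eq_tr hΩ hb u g hg).2 hgu).integral_by_parts hΩ hb
        ((isOmniTrace_iff_mk_eq_tr hΩ hb v h hh).2 hhv) θ⟩
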